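/- **Problems.** A *comparator circuit* on wires $0,\dots,m-1$ is a sequence of gates $(i,j)$; the gate $(i,j)$ replaces the bits $p,q$ on the wires $i,j$ by $p\wedge q$ on wire $i$ and $p\vee q$ on wire $j$ (and does nothing if $i=j$). A comparator circuit *with negation gates* may also contain gates that invert the bit on one wire. - $\textsc{Ccv}$: given a comparator circuit, an input bit for each wire and a designated wire, decide whether that wire outputs $1$. - $\textsc{Ccv}\neg$: the same problem for comparator circuits with negation gates. Let $G=(V,W,E)$ be a bipartite graph with bottom nodes $V=\{v_0,\dots,v_{m-1}\}$, top nodes $W=\{w_0,\dots,w_{n-1}\}$ and $E\subseteq V\times W$. The *lexicographically first maximal matching* (lfm-matching) of $G$ is the matching obtained by treating $v_0,\dots,v_{m-1}$ in this order and matching each of them to its least neighbour in $W$ that is still unmatched, if there is one. - $\textsc{Lfmm}$: given $G$ and a designated edge of $G$, decide whether the edge belongs to the lfm-matching of $G$. - $\textsc{vLfmm}$: given $G$ and a designated top node, decide whether this node is matched in the lfm-matching of $G$. - $\textsc{3Lfmm}$ and $\textsc{3vLfmm}$: the restrictions of $\textsc{Lfmm}$ and $\textsc{vLfmm}$ to bipartite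 graphs in which every node has degree at most three. Instances are encoded as binary strings: sizes in unary with an end mark, wires and nodes as blocks of bits with a single $1$ at the position of the index, gates as sequences of fixed-length blocks, and graphs by their adjacency matrices. A string that encodes no instance of a problem is a negative input for it. **Reductions.** $\mathsf{AC}^0$ is uniform $\mathsf{AC}^0$ in its first-order form: a relation of a binary string $X$ and of numbers $x_1,\dots,x_k$ (given in unary) is in $\mathsf{AC}^0$ if it is defined by a first-order formula over the natural numbers with $0,1,+,\cdot,<,=$, the length $|X|$ and the predicate "the $i$-th bit of $X$ is $1$", all of whose quantifiers are bounded by polynomials in $|X|$ and the other number variables. A function $F\colon\{0,1\}^*\to\{0,1\}^*$ is in $\mathsf{FAC}^0$ if $|F(X)|$ is bounded by a polynomial in $|X|$ and the relations "$i<|F(X)|$" and "the $i$-th bit of $F(X)$ is $1$" of $(i,X)$ are in $\mathsf{AC}^0$. A problem $P\subseteq\{0,1\}^*$ is $\mathsf{AC}^0$ many-one reducible to $Q\subseteq\{0,1\}^*$ if there is an $F$ in $\mathsf{FAC}^0$ with $X\in P\Leftrightarrow F(X)\in Q$ for all $X$; $P$ and $Q$ are equivalent if each is so reducible to the other. **Statement.**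 Any two of the six problems $\textsc{Ccv}$, $\textsc{3vLfmm}$, $\textsc{vLfmm}$, $\textsc{Ccv}\neg$, $\textsc{3Lfmm}$ and $\textsc{Lfmm}$ are equivalent under $\mathsf{AC}^0$ many-one reductions. -/

import Mathlib

namespace ComparatorCC

/-! ### Uniform AC⁰, as first-order definability with arithmetic

A relation of a binary string `X` and of `k` numbers (given in unary) is in uniform AC⁰ iff it is
defined by a first-order formula over the natural numbers with `+`, `*`, `<`, `=`, the length of
`X` and the bits of `X`, all of whose quantifiers are bounded by terms, that is, by
polynomials in the length of `X` and in the other numbers. -/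

/-- Number terms in `k` number variables: polynomials in the variables and in the length of the
input string. -/
inductive NumTerm (k : ℕ) : Type
  | var (i : Fin k) : NumTerm k
  | len : NumTerm k
  | zero : NumTerm k
  | one : NumTerm k
  | add (s t : NumTerm k) : NumTerm k
  | mul (s t : NumTerm k) : NumTerm k

/-- The value of a term at the input string `X` and the numbers `v`. -/
def NumTerm.eval {k : ℕ} (X : List Bool) (v : Fin k → ℕ) : NumTerm k → ℕ
  | .var i => v i
  | .len => X.length
  | .zero => 0
  | .one => 1
  | .add s t => s.eval X v + t.eval X v
  | .mul s t => s.eval X v * t.eval X v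

/-- First-order formulas with `k` free number variables and bounded quantifiers. A quantifier
binds variable `0` of its body; its bound is a term in the outer variables only. -/
inductive BddFormula : ℕ → Type
  | lt {k : ℕ} (s t : NumTerm k) : BddFormula k
  | eq {k : ℕ} (s t : NumTerm k) : BddFormula k
  | bit {k : ℕ} (t : NumTerm k) : BddFormula k
  | not {k : ℕ} (φ : BddFormula k) : BddFormula k
  | and {k : ℕ} (φ ψ : BddFormula k) : BddFormula k
  | or {k : ℕ} (φ ψ : BddFormula k) : BddFormula k
  | all {k : ℕ} (b : NumTerm k) (φ : BddFormula (k + 1)) : BddFormula k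
  | ex {k : ℕ} (b : NumTerm k) (φ : BddFormula (k + 1)) : BddFormula k

/-- Truth of a formula at the input string `X` and the numbers `v`; positions in `X` are counted
from `0`, and there is no `1` beyond the end of `X`. -/
def BddFormula.Holds (X : List Bool) : {k : ℕ} → BddFormula k → (Fin k → ℕ) → Prop
  | _, .lt s t, v => s.eval X v < t.eval X v
  | _, .eq s t, v => s.eval X v = t.eval X v
  | _, .bit t, v => X[t.eval X v]? = some true
  | _, .not φ, v => ¬ φ.Holds X v
  | _, .and φ ψ, v => φ.Holds X v ∧ ψ.Holds X v
  | _, .or φ ψ, v => φ.Holds X v ∨ ψ.Holds X v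
  | _, .all b φ, v => ∀ x : ℕ, x < b.eval X v → φ.Holds X (Fin.cons x v)
  | _, .ex b φ, v => ∃ x : ℕ, x < b.eval X v ∧ φ.Holds X (Fin.cons x v)

/-- The relation `R`, of a binary string and `k` unary numbers, is in uniform AC⁰. -/
def IsAC0 {k : ℕ} (R : List Bool → (Fin k → ℕ) → Prop) : Prop :=
  ∃ φ : BddFormula k, ∀ (X : List Bool) (v : Fin k → ℕ), φ.Holds X v ↔ R X v

/-- The string function `F` is in FAC⁰: its length is polynomially bounded and its bit graph is in
AC⁰. As strings may end in zeros, the length of `F X` has to be AC⁰ too. -/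
structure IsFAC0 (F : List Bool → List Bool) : Prop where
  polyBounded : ∃ p : Polynomial ℕ, ∀ X : List Bool, (F X).length ≤ p.eval X.length
  length_ac0 : IsAC0 (k := 1) fun X v => v 0 < (F X).length
  bitGraph_ac0 : IsAC0 (k := 1) fun X v => (F X)[v 0]? = some true

/-- `P` is AC⁰ many-one reducible to `Q`. -/
def AC0Reducible (P Q : Language Bool) : Prop :=
  ∃ F : List Bool → List Bool, IsFAC0 F ∧ ∀ X : List Bool, X ∈ P ↔ F X ∈ Q

/-- `P` and `Q` are equivalent under AC⁰ many-one reductions. -/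
def AC0Equivalent (P Q : Language Bool) : Prop :=
  AC0Reducible P Q ∧ AC0Reducible Q P

/-! ### Strings for numbers -/

/-- A size, in unary with an end mark. -/
def encSize (m : ℕ) : List Bool :=
  List.replicate m true ++ [false]

/-- An index below `m`, as a block of `m` bits whose only `1` is at that index. -/
def encIndex {m : ℕ} (i : Fin m) : List Bool :=
  List.ofFn fun j : Fin m => decide (j = i)

/-! ### Comparator circuits -/

/-- The comparator gate `(i, j)`: wire `i` gets the conjunction and wire `j` the disjunction of
the two bits. (For `i = j` this does nothing.) -/
def comparator {m : ℕ} (i j : Fin m) (w : Fin m → Bool) : Fin m → Bool :=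
  Function.update (Function.update w i (w i && w j)) j (w i || w j)

/-- An instance of the comparator circuit value problem: `m` wires, their input bits, the sequence
of comparator gates, and the designated wire. -/
structure CcvInstance where
  m : ℕ
  input : Fin m → Bool
  gates : List (Fin m × Fin m)
  out : Fin m

namespace CcvInstance

/-- The bits on the wires after all gates. -/
def output (I : CcvInstance) : Fin I.m → Bool :=
  I.gates.foldl (fun w g => comparator g.1 g.2 w) I.input

/-- The number of wires, the number of gates, the input bits, the designated wire, the gates. -/
def encode (I : CcvInstance) : List Bool :=
  encSize I.m ++ encSize I.gates.length ++ List.ofFn I.input ++ encIndex I.out ++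
    I.gates.flatMap fun g => encIndex g.1 ++ encIndex g.2

end CcvInstance

/-- A gate of a comparator circuit with negation gates on `m` wires. -/
inductive GateNeg (m : ℕ) : Type
  | comp (i j : Fin m) : GateNeg m
  | neg (i : Fin m) : GateNeg m

/-- The action of a gate on the bits of the wires. -/
def GateNeg.apply {m : ℕ} : GateNeg m → (Fin m → Bool) → (Fin m → Bool)
  | .comp i j, w => comparator i j w
  | .neg i, w => Function.update w i (!w i)

/-- A gate as `2 * m + 1` bits: its kind, and its two wires (for a negation gate, its wire and an
unused block of zeros). -/
def GateNeg.encode {m : ℕ} : GateNeg m → List Bool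
  | .comp i j => false :: (encIndex i ++ encIndex j)
  | .neg i => true :: (encIndex i ++ List.replicate m false)

/-- An instance of the comparator circuit value problem with negation gates. -/
structure CcvNegInstance where
  m : ℕ
  input : Fin m → Bool
  gates : List (GateNeg m)
  out : Fin m

namespace CcvNegInstance

/-- The bits on the wires after all gates. -/
def output (I : CcvNegInstance) : Fin I.m → Bool :=
  I.gates.foldl (fun w g => g.apply w) I.input

/-- The number of wires, the number of gates, the input bits, the designated wire, the gates. -/
def encode (I : CcvNegInstance) : List Bool :=
  encSize I.m ++ encSize I.gates.length ++ List.ofFn I.input ++ encIndex I.out ++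
    I.gates.flatMap GateNeg.encode

end CcvNegInstance

/-! ### Lexicographically first maximal matchings -/

/-- A bipartite graph with bottom nodes `0, …, m - 1` and top nodes `0, …, n - 1`. -/
structure BipGraph where
  m : ℕ
  n : ℕ
  adj : Fin m → Fin n → Bool

namespace BipGraph

/-- Match the bottom node `v` to its least neighbour that is not matched in `M` (if there is
one). -/
def lfmStep (G : BipGraph) (M : List (Fin G.m × Fin G.n)) (v : Fin G.m) :
    List (Fin G.m × Fin G.n) :=
  match (List.finRange G.n).find? fun w => G.adj v w && !(M.map Prod.snd).contains w with
  | some w => M ++ [(v, w)]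
  | none => M

/-- The edges of the lexicographically first maximal matching: the bottom nodes `0, …, m - 1` are
matched successively. -/
def lfm (G : BipGraph) : List (Fin G.m × Fin G.n) :=
  (List.finRange G.m).foldl G.lfmStep []

/-- All nodes, bottom and top, have degree at most three. -/
def DegLeThree (G : BipGraph) : Prop :=
  (∀ v : Fin G.m, (Finset.univ.filter fun w : Fin G.n => G.adj v w = true).card ≤ 3) ∧
    ∀ w : Fin G.n, (Finset.univ.filter fun v : Fin G.m => G.adj v w = true).card ≤ 3

/-- The numbers of bottom and of top nodes, and the adjacency matrix, row by row. -/
def encode (G : BipGraph) : List Bool :=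
  encSize G.m ++ encSize G.n ++ (List.finRange G.m).flatMap fun v => List.ofFn (G.adj v)

end BipGraph

/-- A bipartite graph with a designated top node. -/
structure VLfmmInstance where
  G : BipGraph
  top : Fin G.n

namespace VLfmmInstance

/-- The designated top node is matched in the lfm-matching. -/
def Yes (I : VLfmmInstance) : Prop :=
  ∃ v : Fin I.G.m, (v, I.top) ∈ I.G.lfm

/-- The graph, followed by the designated top node. -/
def encode (I : VLfmmInstance) : List Bool :=
  I.G.encode ++ encIndex I.top

end VLfmmInstance

/-- A bipartite graph with a designated edge. -/
structure LfmmInstance where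
  G : BipGraph
  bot : Fin G.m
  top : Fin G.n
  isEdge : G.adj bot top = true

namespace LfmmInstance

/-- The designated edge belongs to the lfm-matching. -/
def Yes (I : LfmmInstance) : Prop :=
  (I.bot, I.top) ∈ I.G.lfm

/-- The graph, followed by the two ends of the designated edge. -/
def encode (I : LfmmInstance) : List Bool :=
  I.G.encode ++ encIndex I.bot ++ encIndex I.top

end LfmmInstance

/-! ### The decision problems

Each is the set of the strings that encode a positive instance. -/

/-- The comparator circuit value problem. -/
def Ccv : Language Bool :=
  {X | ∃ I : CcvInstance, I.encode = X ∧ I.output I.out = true}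

/-- The comparator circuit value problem with negation gates. -/
def CcvNeg : Language Bool :=
  {X | ∃ I : CcvNegInstance, I.encode = X ∧ I.output I.out = true}

/-- Lexicographically first maximal matching, edge version. -/
def Lfmm : Language Bool :=
  {X | ∃ I : LfmmInstance, I.encode = X ∧ I.Yes}

/-- The edge version for graphs of degree at most three. -/
def Lfmm3 : Language Bool :=
  {X | ∃ I : LfmmInstance, I.encode = X ∧ I.G.DegLeThree ∧ I.Yes}

/-- Lexicographically first maximal matching, vertex version. -/
def VLfmm : Language Bool :=
  {X | ∃ I : VLfmmInstance, I.encode = X ∧ I.Yes}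

/-- The vertex version for graphs of degree at most three. -/
def VLfmm3 : Language Bool :=
  {X | ∃ I : VLfmmInstance, I.encode = X ∧ I.G.DegLeThree ∧ I.Yes}

end ComparatorCC

/-!
The six problems are reduced to one another along the two cycles

* `Ccv → VLfmm3 → VLfmm → CcvNeg → Ccv` and
* `Ccv → Lfmm3 → Lfmm → CcvNeg → Ccv`,

so that any two of them are equivalent, AC⁰ reductions being closed under composition
(`AC0Reducible.trans`). The steps from `VLfmm3` to `VLfmm` and from `Lfmm3` to `Lfmm` keep the instances
and only check, in AC⁰, that all degrees are at most three.

*Matchings by circuits.* The construction of the lfm-matching is a run of comparators: a bottom node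
carries `1` as long as it is unmatched, a top node carries `1` as soon as it is matched, and for each
edge `(v, w)`, in lexicographic order, the comparator `(v, w)` moves the `1` from `v` to `w` if `w`
is still free (`Simulates.wiresAt`). At the end, wire `w` tells whether `w` is matched. For a
designated edge, the run is stopped just before the gate of this edge; the edge is chosen iff both of
its ends are then unmatched, which is computed with one negation gate and one further comparator.

*Negation gates.* In the double-rail form of a circuit, each bit comes with its negation, a
comparator is accompanied by its dual, and a negation is the exchange of the two wires, by three
comparators with an auxiliary wire that carries `0` (`doubleRail_state`).

*Circuits by matchings.* In `layeredGraph`, the top nodes are the pairs `(l, z)` of a time and a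
wire, and the invariant `matched_layers` says that the matched ones among those of layer `l` are the
wires that carry `1` after `l` gates, when all bottom nodes before layer `l` have been
processed. A bottom node `(l, z)` takes the top node `(l, z)` if this is free, and is then lost;
otherwise it moves on to layer `l + 1`, to the same wire if `z` is not on gate `l`, and to one of
the two outputs of the gate if it is. The disjunction output comes first, so that it
receives the first `1` and the conjunction output receives the second one. All degrees are at most
three. A last bottom node reads the output: it is matched to the last top node iff
the top node of the output is already matched.

*Definability.* Membership in AC⁰ is a class (`AC0Fun`, `AC0Rel`, `FAC0`), and the closure properties
of AC⁰ are its instances, so that the definability of a reduction is found by instance search. To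
keep dependent types away from the search, instances of the problems are replaced by data over the
natural numbers, `RawCircuit` and `RawGraph`. A `Presentation` collects what is needed of
such data; in particular, they can be read off a string in AC⁰, and a string is an instance iff
encoding what is read off it gives this string. A definable map of data that
preserves the answer is then a reduction (`Presentation.reducible`).
-/

namespace ComparatorCC

/-! ### Closure properties of uniform AC⁰ -/

/-- Renaming of the variables of a term. -/
def NumTerm.rename {k l : ℕ} (σ : Fin k → Fin l) : NumTerm k → NumTerm l
  | .var i => .var (σ i)
  | .len => .len
  | .zero => .zero
  | .one => .one
  | .add s t => .add (s.rename σ) (t.rename σ)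
  | .mul s t => .mul (s.rename σ) (t.rename σ)

theorem NumTerm.eval_rename {k l : ℕ} (σ : Fin k → Fin l) (X : List Bool) (v : Fin l → ℕ)
    (t : NumTerm k) : (t.rename σ).eval X v = t.eval X (v ∘ σ) := by
  induction t <;> simp_all [NumTerm.rename, NumTerm.eval]

/-- Renaming of the free variables of a formula; the bound variable `0` of a quantifier is kept. -/
def BddFormula.rename : {k : ℕ} → BddFormula k → {l : ℕ} → (Fin k → Fin l) → BddFormula l
  | _, .lt s t, _, σ => .lt (s.rename σ) (t.rename σ)
  | _, .eq s t, _, σ => .eq (s.rename σ) (t.rename σ)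
  | _, .bit t, _, σ => .bit (t.rename σ)
  | _, .not φ, _, σ => .not (φ.rename σ)
  | _, .and φ ψ, _, σ => .and (φ.rename σ) (ψ.rename σ)
  | _, .or φ ψ, _, σ => .or (φ.rename σ) (ψ.rename σ)
  | _, .all b φ, _, σ => .all (b.rename σ) (φ.rename (Fin.cons 0 (Fin.succ ∘ σ)))
  | _, .ex b φ, _, σ => .ex (b.rename σ) (φ.rename (Fin.cons 0 (Fin.succ ∘ σ)))

theorem cons_comp_lift {k l : ℕ} (σ : Fin k → Fin l) (x : ℕ) (v : Fin l → ℕ) :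
    (Fin.cons x v : Fin (l + 1) → ℕ) ∘ (Fin.cons 0 (Fin.succ ∘ σ) : Fin (k + 1) → Fin (l + 1)) =
      Fin.cons x (v ∘ σ) := by
  funext i
  refine Fin.cases ?_ (fun j => ?_) i <;> simp

theorem BddFormula.holds_rename {k : ℕ} (φ : BddFormula k) (X : List Bool) :
    ∀ {l : ℕ} (σ : Fin k → Fin l) (v : Fin l → ℕ),
      (φ.rename σ).Holds X v ↔ φ.Holds X (v ∘ σ) := by
  induction φ with
  | all b φ ih =>
    intro l σ v
    simp only [BddFormula.rename, BddFormula.Holds, NumTerm.eval_rename, ih, cons_comp_lift]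
  | ex b φ ih =>
    intro l σ v
    simp only [BddFormula.rename, BddFormula.Holds, NumTerm.eval_rename, ih, cons_comp_lift]
  | _ => intros; simp_all [BddFormula.rename, BddFormula.Holds, NumTerm.eval_rename]

section Basic

variable {k : ℕ} {R S : List Bool → (Fin k → ℕ) → Prop}

theorem IsAC0.congr (hR : IsAC0 R) (h : ∀ X v, R X v ↔ S X v) : IsAC0 S :=
  hR.imp fun _ hφ X v => (hφ X v).trans (h X v)

theorem IsAC0.rename (hR : IsAC0 R) {l : ℕ} (σ : Fin k → Fin l) :
    IsAC0 fun X v => R X (v ∘ σ) := by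
  obtain ⟨φ, hφ⟩ := hR
  exact ⟨φ.rename σ, fun X v => (φ.holds_rename X σ v).trans (hφ _ _)⟩

theorem IsAC0.not (hR : IsAC0 R) : IsAC0 fun X v => ¬ R X v := by
  obtain ⟨φ, hφ⟩ := hR
  exact ⟨.not φ, fun X v => not_congr (hφ _ _)⟩

theorem IsAC0.and (hR : IsAC0 R) (hS : IsAC0 S) : IsAC0 fun X v => R X v ∧ S X v := by
  obtain ⟨φ, hφ⟩ := hR
  obtain ⟨ψ, hψ⟩ := hS
  exact ⟨.and φ ψ, fun X v => and_congr (hφ _ _) (hψ _ _)⟩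

theorem IsAC0.or (hR : IsAC0 R) (hS : IsAC0 S) : IsAC0 fun X v => R X v ∨ S X v := by
  obtain ⟨φ, hφ⟩ := hR
  obtain ⟨ψ, hψ⟩ := hS
  exact ⟨.or φ ψ, fun X v => or_congr (hφ _ _) (hψ _ _)⟩

theorem IsAC0.exTerm (b : NumTerm k) {R : List Bool → (Fin (k + 1) → ℕ) → Prop} (hR : IsAC0 R) :
    IsAC0 fun X v => ∃ x, x < b.eval X v ∧ R X (Fin.cons x v) := by
  obtain ⟨φ, hφ⟩ := hR
  exact ⟨.ex b φ, fun X v => exists_congr fun x => and_congr_right fun _ => hφ _ _⟩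

end Basic

/-- The number function `f` is in AC⁰: it is polynomially bounded and has a graph in AC⁰. It is a
class so that the closure properties below are applied by instance search. -/
class AC0Fun {k : ℕ} (f : List Bool → (Fin k → ℕ) → ℕ) : Prop where
  bounded : ∃ t : NumTerm k, ∀ X v, f X v ≤ t.eval X v
  graph : IsAC0 fun X (v : Fin (k + 1) → ℕ) => v 0 = f X (Fin.tail v)

/-- `IsAC0` as a class, so that definability is found by instance search. -/
class AC0Rel {k : ℕ} (R : List Bool → (Fin k → ℕ) → Prop) : Prop where
  isAC0 : IsAC0 R

theorem AC0Rel.congr {k : ℕ} {R S : List Bool → (Fin k → ℕ) → Prop} (hR : AC0Rel R)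
    (h : ∀ X v, R X v ↔ S X v) : AC0Rel S :=
  ⟨hR.isAC0.congr h⟩

theorem AC0Fun.of_term {k : ℕ} (t : NumTerm k) : AC0Fun fun X v => t.eval X v where
  bounded := ⟨t, fun _ _ => le_rfl⟩
  graph := ⟨.eq (.var 0) (t.rename Fin.succ), fun X v => by
    simp only [BddFormula.Holds, NumTerm.eval_rename, NumTerm.eval]; rfl⟩

/-- Substitution of a number function for the variable `0`. -/
theorem IsAC0.subst {k : ℕ} {R : List Bool → (Fin (k + 1) → ℕ) → Prop} (hR : IsAC0 R)
    (f : List Bool → (Fin k → ℕ) → ℕ) [hf : AC0Fun f] :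
    IsAC0 fun X v => R X (Fin.cons (f X v) v) := by
  obtain ⟨t, ht⟩ := hf.bounded
  refine (IsAC0.exTerm (.add t .one) (hf.graph.and hR)).congr fun X v => ?_
  simp only [NumTerm.eval, Fin.cons_zero, Fin.tail_cons]
  constructor
  · rintro ⟨x, -, rfl, h⟩
    exact h
  · exact fun h => ⟨_, Nat.lt_succ_of_le (ht X v), rfl, h⟩

/-! The head of a weakening rule is a variable, so that it competes with every other rule; these
rules therefore come last in the search. -/

section Weakening

variable {k : ℕ}

instance (priority := low) AC0Fun.tail (f : List Bool → (Fin k → ℕ) → ℕ) [hf : AC0Fun f] :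
    AC0Fun fun X (v : Fin (k + 1) → ℕ) => f X (Fin.tail v) where
  bounded := by
    obtain ⟨t, ht⟩ := hf.bounded
    exact ⟨t.rename Fin.succ, fun X v => by rw [NumTerm.eval_rename]; exact ht X _⟩
  graph := (hf.graph.rename (Fin.cons 0 (Fin.succ ∘ Fin.succ))).congr fun _ _ => Iff.rfl

instance (priority := low) AC0Fun.tail₂ (f : List Bool → (Fin k → ℕ) → ℕ) [AC0Fun f] :
    AC0Fun fun X (v : Fin (k + 2) → ℕ) => f X (Fin.tail (Fin.tail v)) :=
  AC0Fun.tail fun X v => f X (Fin.tail v)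

instance (priority := low) AC0Fun.tail₃ (f : List Bool → (Fin k → ℕ) → ℕ) [AC0Fun f] :
    AC0Fun fun X (v : Fin (k + 3) → ℕ) => f X (Fin.tail (Fin.tail (Fin.tail v))) :=
  AC0Fun.tail fun X v => f X (Fin.tail (Fin.tail v))

instance (priority := low) AC0Fun.tail₄ (f : List Bool → (Fin k → ℕ) → ℕ) [AC0Fun f] :
    AC0Fun fun X (v : Fin (k + 4) → ℕ) => f X (Fin.tail (Fin.tail (Fin.tail (Fin.tail v)))) :=
  AC0Fun.tail fun X v => f X (Fin.tail (Fin.tail (Fin.tail v)))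

instance (priority := low) AC0Rel.tail (R : List Bool → (Fin k → ℕ) → Prop) [hR : AC0Rel R] :
    AC0Rel fun X (v : Fin (k + 1) → ℕ) => R X (Fin.tail v) :=
  ⟨hR.isAC0.rename Fin.succ⟩

instance AC0Fun.var (i : Fin k) : AC0Fun fun _ v => v i :=
  AC0Fun.of_term (.var i)

instance AC0Fun.tail_var (i : Fin k) : AC0Fun fun _ (v : Fin (k + 1) → ℕ) => Fin.tail v i :=
  AC0Fun.tail fun _ v => v i

instance AC0Fun.tail₂_var (i : Fin k) :
    AC0Fun fun _ (v : Fin (k + 2) → ℕ) => Fin.tail (Fin.tail v) i :=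
  AC0Fun.tail₂ fun _ v => v i

instance AC0Fun.tail₃_var (i : Fin k) :
    AC0Fun fun _ (v : Fin (k + 3) → ℕ) => Fin.tail (Fin.tail (Fin.tail v)) i :=
  AC0Fun.tail₃ fun _ v => v i

instance AC0Fun.tail₄_var (i : Fin k) :
    AC0Fun fun _ (v : Fin (k + 4) → ℕ) => Fin.tail (Fin.tail (Fin.tail (Fin.tail v))) i :=
  AC0Fun.tail₄ fun _ v => v i

end Weakening

/-- Substitution of number functions into a relation of three numbers. -/
theorem IsAC0.subst₃ {k : ℕ} {R : List Bool → ℕ → ℕ → ℕ → Prop}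
    (hR : IsAC0 fun X (v : Fin 3 → ℕ) => R X (v 0) (v 1) (v 2))
    (f g h : List Bool → (Fin k → ℕ) → ℕ) [AC0Fun f] [AC0Fun g] [AC0Fun h] :
    IsAC0 fun X v => R X (f X v) (g X v) (h X v) := by
  have h₁ : IsAC0 fun X (v : Fin (k + 3) → ℕ) => R X (v 0) (v 1) (v 2) :=
    hR.rename (Fin.castLE (by omega))
  have h₂ := h₁.subst fun X (v : Fin (k + 2) → ℕ) => f X (Fin.tail (Fin.tail v))
  have h₃ := h₂.subst fun X (v : Fin (k + 1) → ℕ) => g X (Fin.tail v)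
  exact h₃.subst h

section Closure

variable {k : ℕ}

instance AC0Fun.length : AC0Fun fun X (_ : Fin k → ℕ) => X.length :=
  AC0Fun.of_term .len

theorem exists_numeral (k c : ℕ) :
    ∃ t : NumTerm k, ∀ X v, t.eval X v = c := by
  induction c with
  | zero => exact ⟨.zero, fun _ _ => rfl⟩
  | succ c ih =>
    obtain ⟨t, ht⟩ := ih
    exact ⟨.add t .one, fun X v => by simp [NumTerm.eval, ht]⟩

-- High priority: a constant would otherwise be unified with the heads of the rules below, as in
-- `c = ?f + ?g`.
instance (priority := high) AC0Fun.const (c : ℕ) : AC0Fun fun _ (_ : Fin k → ℕ) => c := by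
  obtain ⟨t, ht⟩ := exists_numeral k c
  simpa only [ht] using AC0Fun.of_term t

variable (f g : List Bool → (Fin k → ℕ) → ℕ) [hf : AC0Fun f] [hg : AC0Fun g]

instance AC0Rel.lt : AC0Rel fun X v => f X v < g X v :=
  ⟨IsAC0.subst₃ (R := fun _ a b _ => a < b)
    ⟨.lt (.var 0) (.var 1), fun _ _ => Iff.rfl⟩ f g (fun _ _ => 0)⟩

instance AC0Rel.eq : AC0Rel fun X v => f X v = g X v :=
  ⟨IsAC0.subst₃ (R := fun _ a b _ => a = b)
    ⟨.eq (.var 0) (.var 1), fun _ _ => Iff.rfl⟩ f g (fun _ _ => 0)⟩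

instance AC0Rel.bit : AC0Rel fun X v => X[f X v]? = some true :=
  ⟨IsAC0.subst₃ (R := fun X a _ _ => X[a]? = some true)
    ⟨.bit (.var 0), fun _ _ => Iff.rfl⟩ f (fun _ _ => 0) (fun _ _ => 0)⟩

instance AC0Fun.add : AC0Fun fun X v => f X v + g X v where
  bounded := by
    obtain ⟨s, hs⟩ := hf.bounded
    obtain ⟨t, ht⟩ := hg.bounded
    exact ⟨.add s t, fun X v => Nat.add_le_add (hs X v) (ht X v)⟩
  graph := IsAC0.subst₃ (R := fun _ a b c => a = b + c)
    ⟨.eq (.var 0) (.add (.var 1) (.var 2)), fun _ _ => Iff.rfl⟩ (fun _ v => v 0)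
    (fun X v => f X (Fin.tail v)) (fun X v => g X (Fin.tail v))

instance AC0Fun.mul : AC0Fun fun X v => f X v * g X v where
  bounded := by
    obtain ⟨s, hs⟩ := hf.bounded
    obtain ⟨t, ht⟩ := hg.bounded
    exact ⟨.mul s t, fun X v => Nat.mul_le_mul (hs X v) (ht X v)⟩
  graph := IsAC0.subst₃ (R := fun _ a b c => a = b * c)
    ⟨.eq (.var 0) (.mul (.var 1) (.var 2)), fun _ _ => Iff.rfl⟩ (fun _ v => v 0)
    (fun X v => f X (Fin.tail v)) (fun X v => g X (Fin.tail v))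

instance AC0Rel.not (R : List Bool → (Fin k → ℕ) → Prop) [hR : AC0Rel R] :
    AC0Rel fun X v => ¬ R X v :=
  ⟨hR.isAC0.not⟩

instance AC0Rel.and (R S : List Bool → (Fin k → ℕ) → Prop) [hR : AC0Rel R] [hS : AC0Rel S] :
    AC0Rel fun X v => R X v ∧ S X v :=
  ⟨hR.isAC0.and hS.isAC0⟩

instance AC0Rel.or (R S : List Bool → (Fin k → ℕ) → Prop) [hR : AC0Rel R] [hS : AC0Rel S] :
    AC0Rel fun X v => R X v ∨ S X v :=
  ⟨hR.isAC0.or hS.isAC0⟩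

instance AC0Rel.imp (R S : List Bool → (Fin k → ℕ) → Prop) [AC0Rel R] [AC0Rel S] :
    AC0Rel fun X v => R X v → S X v :=
  AC0Rel.congr (R := fun X v => ¬ R X v ∨ S X v) inferInstance fun _ _ => imp_iff_not_or.symm

instance AC0Rel.iff (R S : List Bool → (Fin k → ℕ) → Prop) [AC0Rel R] [AC0Rel S] :
    AC0Rel fun X v => R X v ↔ S X v :=
  AC0Rel.congr (R := fun X v => (R X v → S X v) ∧ (S X v → R X v)) inferInstance
    fun _ _ => iff_def.symm

instance AC0Rel.ex (R : List Bool → (Fin k → ℕ) → ℕ → Prop)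
    [hR : AC0Rel fun X (v : Fin (k + 1) → ℕ) => R X (Fin.tail v) (v 0)] :
    AC0Rel fun X v => ∃ x, x < f X v ∧ R X v x := by
  obtain ⟨t, ht⟩ := hf.bounded
  refine ⟨(IsAC0.exTerm t (R := fun X v => v 0 < f X (Fin.tail v) ∧ R X (Fin.tail v) (v 0))
    (AC0Rel.isAC0)).congr fun X v => exists_congr fun x => ?_⟩
  simp only [Fin.cons_zero, Fin.tail_cons]
  exact ⟨And.right, fun h => ⟨h.1.trans_le (ht X v), h⟩⟩

instance AC0Rel.all (R : List Bool → (Fin k → ℕ) → ℕ → Prop)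
    [hR : AC0Rel fun X (v : Fin (k + 1) → ℕ) => R X (Fin.tail v) (v 0)] :
    AC0Rel fun X v => ∀ x, x < f X v → R X v x :=
  AC0Rel.congr (R := fun X v => ¬ ∃ x, x < f X v ∧ ¬ R X v x) inferInstance
    fun _ _ => by simp

instance AC0Rel.le : AC0Rel fun X v => f X v ≤ g X v :=
  AC0Rel.congr (R := fun X v => ¬ g X v < f X v) inferInstance fun _ _ => not_lt

instance AC0Rel.ne : AC0Rel fun X v => f X v ≠ g X v :=
  inferInstanceAs (AC0Rel fun X v => ¬ f X v = g X v)

instance AC0Rel.const (p : Prop) : AC0Rel fun _ (_ : Fin k → ℕ) => p := by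
  by_cases h : p
  · exact AC0Rel.congr (R := fun _ _ => 0 = 0) inferInstance fun _ _ => by simp [h]
  · exact AC0Rel.congr (R := fun _ _ => 0 = 1) inferInstance fun _ _ => by simp [h]

/-- A function is in AC⁰ if it is bounded by one in AC⁰ and its graph is definable. -/
theorem AC0Fun.of_graph {f : List Bool → (Fin k → ℕ) → ℕ} (b : List Bool → (Fin k → ℕ) → ℕ)
    [hb : AC0Fun b] (hfb : ∀ X v, f X v ≤ b X v) (R : List Bool → (Fin k → ℕ) → ℕ → Prop)
    [hR : AC0Rel fun X (v : Fin (k + 1) → ℕ) => R X (Fin.tail v) (v 0)]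
    (h : ∀ X v y, R X v y ↔ y = f X v) : AC0Fun f where
  bounded := hb.bounded.imp fun _ ht X v => (hfb X v).trans (ht X v)
  graph := hR.isAC0.congr fun _ _ => h _ _ _

instance AC0Fun.sub : AC0Fun fun X v => f X v - g X v :=
  AC0Fun.of_graph f (fun _ _ => Nat.sub_le _ _)
    (fun X v y => (f X v ≤ g X v ∧ y = 0) ∨ (g X v < f X v ∧ f X v = y + g X v))
    fun X v y => by omega

instance AC0Fun.div : AC0Fun fun X v => f X v / g X v :=
  AC0Fun.of_graph f (fun _ _ => Nat.div_le_self _ _)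
    (fun X v y => (g X v = 0 ∧ y = 0) ∨ (y * g X v ≤ f X v ∧ f X v < (y + 1) * g X v))
    fun X v y => by
      rcases Nat.eq_zero_or_pos (g X v) with h | h
      · simp [h]
      · rw [@eq_comm _ y (f X v / g X v), Nat.div_eq_iff h, add_mul, one_mul]
        omega

instance AC0Fun.mod : AC0Fun fun X v => f X v % g X v :=
  AC0Fun.of_graph f (fun _ _ => Nat.mod_le _ _)
    (fun X v y => y = f X v - g X v * (f X v / g X v))
    fun X v y => by rw [Nat.mod_eq_sub_mul_div]

instance AC0Fun.ite (R : List Bool → (Fin k → ℕ) → Prop) [d : ∀ X v, Decidable (R X v)]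
    [AC0Rel R] : AC0Fun fun X v => if R X v then f X v else g X v :=
  AC0Fun.of_graph (fun X v => f X v + g X v) (fun X v => by split_ifs <;> omega)
    (fun X v y => (R X v ∧ y = f X v) ∨ (¬ R X v ∧ y = g X v))
    fun X v y => by by_cases h : R X v <;> simp [h]

instance AC0Rel.ite (R S T : List Bool → (Fin k → ℕ) → Prop) [d : ∀ X v, Decidable (R X v)]
    [AC0Rel R] [AC0Rel S] [AC0Rel T] : AC0Rel fun X v => if R X v then S X v else T X v :=
  AC0Rel.congr (R := fun X v => (R X v ∧ S X v) ∨ (¬ R X v ∧ T X v)) inferInstance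
    fun X v => by by_cases h : R X v <;> simp [h]

open Classical in
/-- The least number below `b` with the property `P`, and `b` if there is none. -/
noncomputable def leastBelow (b : ℕ) (P : ℕ → Prop) : ℕ :=
  if h : ∃ x, x < b ∧ P x then Nat.find h else b

theorem eq_leastBelow_iff {b y : ℕ} {P : ℕ → Prop} :
    y = leastBelow b P ↔
      (∀ x, x < y → ¬ P x) ∧ (y < b ∧ P y ∨ y = b) := by
  classical
  unfold leastBelow
  split_ifs with h
  · rw [eq_comm, Nat.find_eq_iff]
    grind
  · grind

theorem leastBelow_le (b : ℕ) (P : ℕ → Prop) : leastBelow b P ≤ b := by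
  have := (eq_leastBelow_iff (b := b) (P := P)).1 rfl
  omega

instance AC0Fun.leastBelow (P : List Bool → (Fin k → ℕ) → ℕ → Prop)
    [hP : AC0Rel fun X (v : Fin (k + 1) → ℕ) => P X (Fin.tail v) (v 0)] :
    AC0Fun fun X v => leastBelow (f X v) (P X v) :=
  haveI : AC0Rel fun X (v : Fin (k + 2) → ℕ) => P X (Fin.tail (Fin.tail v)) (v 0) :=
    ⟨hP.isAC0.rename (Fin.cons 0 (Fin.succ ∘ Fin.succ))⟩
  AC0Fun.of_graph f (fun _ _ => leastBelow_le _ _)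
    (fun X v y => (∀ x, x < y → ¬ P X v x) ∧ (y < f X v ∧ P X v y ∨ y = f X v))
    fun _ _ _ => eq_leastBelow_iff.symm

end Closure

/-! ### String functions in FAC⁰ and the composition of reductions -/

/-- The string function `F` is in FAC⁰, with the length as a number function in AC⁰; equivalent to
`IsFAC0`, and a class for the same reason as `AC0Fun`. -/
class FAC0 (F : List Bool → List Bool) : Prop where
  lengthFun : AC0Fun fun X (_ : Fin 0 → ℕ) => (F X).length
  bitRel : AC0Rel fun X (v : Fin 1 → ℕ) => (F X)[v 0]? = some true

section Context

variable {k : ℕ}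

theorem AC0Rel.comp {R : List Bool → ℕ → Prop} (hR : AC0Rel fun X (v : Fin 1 → ℕ) => R X (v 0))
    (f : List Bool → (Fin k → ℕ) → ℕ) [AC0Fun f] : AC0Rel fun X v => R X (f X v) :=
  ⟨(hR.isAC0.rename fun _ => (0 : Fin (k + 1))).subst f⟩

variable (F : List Bool → List Bool) [hF : FAC0 F]

instance FAC0.length : AC0Fun fun X (_ : Fin k → ℕ) => (F X).length where
  bounded := by
    obtain ⟨t, ht⟩ := hF.lengthFun.bounded
    exact ⟨t.rename Fin.elim0, fun X v => by rw [NumTerm.eval_rename]; exact ht X _⟩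
  graph := (hF.lengthFun.graph.rename fun _ => 0).congr fun _ _ => Iff.rfl

instance FAC0.bit (f : List Bool → (Fin k → ℕ) → ℕ) [AC0Fun f] :
    AC0Rel fun X v => (F X)[f X v]? = some true :=
  AC0Rel.comp (R := fun X i => (F X)[i]? = some true) hF.bitRel f

instance AC0Fun.eval_comp (t : NumTerm k) : AC0Fun fun X v => t.eval (F X) v := by
  induction t <;> simp only [NumTerm.eval] <;> infer_instance

/-- AC⁰ relations are closed under the substitution of a function in FAC⁰ for the string. -/
theorem BddFormula.holds_comp (φ : BddFormula k) : AC0Rel fun X v => φ.Holds (F X) v := by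
  induction φ with
  | all b φ ih =>
    have : AC0Rel fun X (v : Fin (_ + 1) → ℕ) => φ.Holds (F X) (Fin.cons (v 0) (Fin.tail v)) := by
      simpa only [Fin.cons_self_tail] using ih
    exact AC0Rel.all (fun X v => b.eval (F X) v) fun X v x => φ.Holds (F X) (Fin.cons x v)
  | ex b φ ih =>
    have : AC0Rel fun X (v : Fin (_ + 1) → ℕ) => φ.Holds (F X) (Fin.cons (v 0) (Fin.tail v)) := by
      simpa only [Fin.cons_self_tail] using ih
    exact AC0Rel.ex (fun X v => b.eval (F X) v) fun X v x => φ.Holds (F X) (Fin.cons x v)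
  | _ => simp only [BddFormula.Holds]; infer_instance

theorem IsAC0.comp_string {R : List Bool → (Fin k → ℕ) → Prop} (hR : IsAC0 R) :
    AC0Rel fun X v => R (F X) v := by
  obtain ⟨φ, hφ⟩ := hR
  exact (φ.holds_comp F).congr fun X v => hφ _ _

end Context

theorem NumTerm.exists_polynomial (t : NumTerm 0) :
    ∃ p : Polynomial ℕ, ∀ X v, t.eval X v = p.eval X.length := by
  induction t with
  | var i => exact i.elim0
  | len => exact ⟨.X, fun X v => by simp [NumTerm.eval]⟩
  | zero => exact ⟨0, fun X v => by simp [NumTerm.eval]⟩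
  | one => exact ⟨1, fun X v => by simp [NumTerm.eval]⟩
  | add s t hs ht =>
    obtain ⟨p, hp⟩ := hs
    obtain ⟨q, hq⟩ := ht
    exact ⟨p + q, fun X v => by simp [NumTerm.eval, hp, hq]⟩
  | mul s t hs ht =>
    obtain ⟨p, hp⟩ := hs
    obtain ⟨q, hq⟩ := ht
    exact ⟨p * q, fun X v => by simp [NumTerm.eval, hp, hq]⟩

theorem AC0Fun.polynomial (k : ℕ) (p : Polynomial ℕ) :
    AC0Fun fun X (_ : Fin k → ℕ) => p.eval X.length := by
  induction p using Polynomial.induction_on with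
  | C a => simpa using AC0Fun.const a
  | add p q hp hq => simpa using AC0Fun.add _ _
  | monomial n a h =>
    have := AC0Fun.mul _ (fun X _ => X.length) (hf := h)
    simpa [pow_succ, mul_assoc] using this

theorem isFAC0_iff_fac0 {F : List Bool → List Bool} : IsFAC0 F ↔ FAC0 F := by
  constructor
  · rintro ⟨⟨p, hp⟩, hl, hb⟩
    refine ⟨?_, ⟨hb⟩⟩
    have := AC0Fun.polynomial 0 p
    have (k : ℕ) (f : List Bool → (Fin k → ℕ) → ℕ) [AC0Fun f] :=
      AC0Rel.comp (R := fun X i => i < (F X).length) ⟨hl⟩ f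
    refine AC0Fun.of_graph (fun X _ => p.eval X.length) (fun X _ => hp X)
      (fun X v y => (∀ x, x < y → x < (F X).length) ∧ ¬ y < (F X).length) fun X v y => ?_
    constructor
    · rintro ⟨h₁, h₂⟩
      by_contra hne
      have := h₁ (F X).length (by omega)
      omega
    · rintro rfl
      simp
  · intro hF
    obtain ⟨t, ht⟩ := hF.lengthFun.bounded
    obtain ⟨p, hp⟩ := t.exists_polynomial
    exact ⟨⟨p, fun X => (ht X 0).trans_eq (hp X 0)⟩,
      AC0Rel.isAC0 (R := fun X v => v 0 < (F X).length), hF.bitRel.isAC0⟩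

theorem FAC0.comp (G F : List Bool → List Bool) [hG : FAC0 G] [hF : FAC0 F] :
    FAC0 fun X => G (F X) where
  lengthFun := by
    obtain ⟨t, ht⟩ := hG.lengthFun.bounded
    have := hG.lengthFun.graph.comp_string F
    exact AC0Fun.of_graph (fun X v => t.eval (F X) v) (fun X v => ht (F X) v)
      (fun X _ y => y = (G (F X)).length) fun _ _ _ => Iff.rfl
  bitRel := hG.bitRel.isAC0.comp_string F

instance FAC0.id : FAC0 fun X => X where
  lengthFun := AC0Fun.length
  bitRel := AC0Rel.bit fun _ v => v 0

theorem AC0Reducible.refl (P : Language Bool) : AC0Reducible P P :=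
  ⟨fun X => X, isFAC0_iff_fac0.2 FAC0.id, fun _ => Iff.rfl⟩

theorem AC0Reducible.trans {P Q R : Language Bool} (h : AC0Reducible P Q)
    (h' : AC0Reducible Q R) : AC0Reducible P R := by
  obtain ⟨F, hF, hPQ⟩ := h
  obtain ⟨G, hG, hQR⟩ := h'
  have := isFAC0_iff_fac0.1 hF
  have := isFAC0_iff_fac0.1 hG
  exact ⟨fun X => G (F X), isFAC0_iff_fac0.2 (FAC0.comp G F), fun X => (hPQ X).trans (hQR _)⟩

/-! ### Strings given by their bits -/

open Classical in
/-- The string of length `n` with a `1` at position `i` if and only if `P i`. -/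
noncomputable def ofBits (n : ℕ) (P : ℕ → Prop) : List Bool :=
  (List.range n).map fun i => decide (P i)

@[simp] theorem length_ofBits (n : ℕ) (P : ℕ → Prop) : (ofBits n P).length = n := by
  simp [ofBits]

@[simp] theorem bit_ofBits (n : ℕ) (P : ℕ → Prop) (i : ℕ) :
    (ofBits n P)[i]? = some true ↔ i < n ∧ P i := by
  simp [ofBits, List.getElem?_eq_some_iff]

theorem bit_append (A B : List Bool) (i : ℕ) :
    (A ++ B)[i]? = some true ↔
      i < A.length ∧ A[i]? = some true ∨ A.length ≤ i ∧ B[i - A.length]? = some true := by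
  rw [List.getElem?_append]
  split_ifs <;> grind

theorem eq_of_bits {A B : List Bool} (hl : A.length = B.length)
    (h : ∀ i, i < A.length → (A[i]? = some true ↔ B[i]? = some true)) : A = B := by
  refine List.ext_getElem hl fun i hA hB => ?_
  have := h i hA
  simpa [List.getElem?_eq_getElem, hA, hB, ← Bool.eq_iff_iff] using this

theorem ofBits_congr {n : ℕ} {P Q : ℕ → Prop} (h : ∀ i < n, (P i ↔ Q i)) :
    ofBits n P = ofBits n Q :=
  eq_of_bits (by simp) fun i hi => by simp at hi; simp [h i hi]

theorem encSize_eq_ofBits (m : ℕ) : encSize m = ofBits m (fun _ => True) ++ [false] := by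
  simp [encSize, ofBits]

@[simp] theorem length_encSize (m : ℕ) : (encSize m).length = m + 1 := by
  simp [encSize]

theorem ofFn_eq_ofBits {m : ℕ} (f : Fin m → Bool) (P : ℕ → Prop)
    (h : ∀ i : Fin m, f i = true ↔ P i) : List.ofFn f = ofBits m P := by
  refine eq_of_bits (by simp) fun i hi => ?_
  rw [List.length_ofFn] at hi
  have hf : (List.ofFn f)[i]? = some (f ⟨i, hi⟩) := by simp [hi]
  rw [hf, bit_ofBits, Option.some.injEq, h]
  exact ⟨fun hP => ⟨hi, hP⟩, And.right⟩

theorem encIndex_eq_ofBits {m : ℕ} (i : Fin m) : encIndex i = ofBits m (· = i) :=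
  ofFn_eq_ofBits _ _ fun j => by simp [Fin.ext_iff]

theorem ofBits_append (a b : ℕ) (P Q : ℕ → Prop) :
    ofBits a P ++ ofBits b Q = ofBits (a + b) fun i => if i < a then P i else Q (i - a) := by
  refine eq_of_bits (by simp) fun i _ => ?_
  rw [bit_append]
  simp
  grind

/-- A sequence of blocks of the same length. -/
theorem flatMap_ofFn_eq_ofBits {α : Type*} (c n : ℕ) (g : Fin n → α) (e : α → List Bool)
    (P : ℕ → ℕ → Prop) (h : ∀ i : Fin n, e (g i) = ofBits c (P i)) :
    (List.ofFn g).flatMap e = ofBits (n * c) fun p => P (p / c) (p % c) := by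
  induction n with
  | zero => simp [ofBits]
  | succ n ih =>
    rw [List.ofFn_succ', List.concat_eq_append, List.flatMap_append,
      ih (fun i => g i.castSucc) fun i => h i.castSucc]
    simp only [List.flatMap_cons, List.flatMap_nil, List.append_nil, h, ofBits_append,
      add_mul, one_mul]
    refine ofBits_congr fun i hi => ?_
    split_ifs with h'
    · rfl
    · have hc : 0 < c := by
        rcases Nat.eq_zero_or_pos c with rfl | hc <;> omega
      obtain ⟨q, rfl⟩ := Nat.exists_eq_add_of_le (not_lt.1 h')
      have hq : q < c := by omega
      rw [Nat.add_sub_cancel_left, mul_comm n c, Nat.mul_add_div hc, Nat.mul_add_mod,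
        Nat.div_eq_of_lt hq, Nat.mod_eq_of_lt hq]
      simp

instance FAC0.const (A : List Bool) : FAC0 fun _ => A where
  lengthFun := AC0Fun.const _
  bitRel := by
    refine AC0Rel.comp (R := fun _ i => A[i]? = some true) ?_ fun _ v => v 0
    induction A with
    | nil => simpa using AC0Rel.const False
    | cons a A ih =>
      have h := AC0Rel.comp (R := fun _ i => A[i]? = some true) ih
        fun _ (v : Fin 1 → ℕ) => v 0 - 1
      refine AC0Rel.congr (R := fun _ (v : Fin 1 → ℕ) =>
        v 0 = 0 ∧ a = true ∨ v 0 ≠ 0 ∧ A[v 0 - 1]? = some true) inferInstance fun X v => ?_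
      rcases h : v 0 with _ | i <;> simp

instance FAC0.append (F G : List Bool → List Bool) [FAC0 F] [FAC0 G] :
    FAC0 fun X => F X ++ G X where
  lengthFun := by
    simp only [List.length_append]
    infer_instance
  bitRel := by
    simp only [bit_append]
    infer_instance

theorem FAC0.ofBits (n : List Bool → ℕ) (P : List Bool → ℕ → Prop)
    [hn : AC0Fun fun X (_ : Fin 0 → ℕ) => n X]
    [hP : AC0Rel fun X (v : Fin 1 → ℕ) => P X (v 0)] : FAC0 fun X => ofBits (n X) (P X) where
  lengthFun := by simpa using hn
  bitRel := by
    have : AC0Fun fun X (_ : Fin 1 → ℕ) => n X := AC0Fun.tail fun X (_ : Fin 0 → ℕ) => n X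
    simp only [bit_ofBits]
    infer_instance

instance FAC0.encSize (n : List Bool → ℕ) [hn : AC0Fun fun X (_ : Fin 0 → ℕ) => n X] :
    FAC0 fun X => encSize (n X) := by
  simp only [encSize_eq_ofBits]
  have := FAC0.ofBits n fun _ _ => True
  infer_instance

open Classical in
theorem FAC0.ite (R : List Bool → Prop) (F G : List Bool → List Bool)
    [hR : AC0Rel fun X (_ : Fin 0 → ℕ) => R X] [FAC0 F] [FAC0 G] :
    FAC0 fun X => if R X then F X else G X where
  lengthFun := by
    simp only [apply_ite List.length]
    infer_instance
  bitRel := by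
    have : AC0Rel fun X (_ : Fin 1 → ℕ) => R X := AC0Rel.tail fun X (_ : Fin 0 → ℕ) => R X
    refine AC0Rel.congr (R := fun X (v : Fin 1 → ℕ) =>
      if R X then (F X)[v 0]? = some true else (G X)[v 0]? = some true) inferInstance
      fun X v => ?_
    split_ifs <;> rfl

theorem AC0Rel.string_eq (F G : List Bool → List Bool) [FAC0 F] [FAC0 G] :
    AC0Rel fun X (_ : Fin 0 → ℕ) => F X = G X := by
  refine AC0Rel.congr (R := fun X (_ : Fin 0 → ℕ) => (F X).length = (G X).length ∧
    ∀ i, i < (F X).length → ((F X)[i]? = some true ↔ (G X)[i]? = some true)) inferInstance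
    fun X v => ⟨fun h => eq_of_bits h.1 h.2, fun h => by simp [h]⟩

open Classical in
/-- A many-one reduction that sends the strings outside an AC⁰ set `V` to the empty string. -/
theorem AC0Reducible.of_valid {P Q : Language Bool} (V : List Bool → Prop)
    (F : List Bool → List Bool) [AC0Rel fun X (_ : Fin 0 → ℕ) => V X] [FAC0 F]
    (hP : ∀ X ∈ P, V X) (hQ : [] ∉ Q) (h : ∀ X, V X → (X ∈ P ↔ F X ∈ Q)) :
    AC0Reducible P Q := by
  refine ⟨fun X => if V X then F X else [], isFAC0_iff_fac0.2 (FAC0.ite V F _), fun X => ?_⟩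
  by_cases hV : V X
  · simp [hV, h]
  · simp only [hV, if_false, hQ, iff_false]
    exact fun hX => hV (hP X hX)

/-! ### Reading strings -/

/-- The strings of all six problems: two sizes, followed by a string `R`. -/
def withSizes (a b : ℕ) (R : List Bool) : List Bool :=
  encSize a ++ (encSize b ++ R)

/-- The first size in a string. -/
noncomputable def firstSize (X : List Bool) : ℕ :=
  leastBelow X.length fun i => ¬ X[i]? = some true

/-- The second size in a string. -/
noncomputable def secondSize (X : List Bool) : ℕ :=
  leastBelow X.length fun i => ¬ X[firstSize X + 1 + i]? = some true

/-- Bit `i` of the part of a string that follows its two sizes is `1`. -/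
def restBit (X : List Bool) (i : ℕ) : Prop :=
  X[firstSize X + 1 + (secondSize X + 1 + i)]? = some true

section AC0

variable {k : ℕ}

instance AC0Fun.firstSize : AC0Fun fun X (_ : Fin k → ℕ) => firstSize X := by
  unfold ComparatorCC.firstSize
  infer_instance

instance AC0Fun.secondSize : AC0Fun fun X (_ : Fin k → ℕ) => secondSize X := by
  unfold ComparatorCC.secondSize
  infer_instance

instance AC0Rel.restBit (f : List Bool → (Fin k → ℕ) → ℕ) [AC0Fun f] :
    AC0Rel fun X v => restBit X (f X v) := by
  unfold ComparatorCC.restBit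
  infer_instance

end AC0

theorem leastBelow_eq {b y : ℕ} {P : ℕ → Prop} (hy : y < b) (h : ∀ x < b, (P x ↔ x = y)) :
    leastBelow b P = y := by
  refine (eq_leastBelow_iff.2 ⟨fun x hx hP => ?_, Or.inl ⟨hy, (h y hy).2 rfl⟩⟩).symm
  exact hx.ne ((h x (hx.trans hy)).1 hP)

theorem getElem?_append_add {A B : List Bool} {a : ℕ} (h : A.length = a) (i : ℕ) :
    (A ++ B)[a + i]? = B[i]? := by
  rw [List.getElem?_append_right (by omega), h, Nat.add_sub_cancel_left]

theorem leastBelow_encSize (a c : ℕ) (R : List Bool) (hc : a < c) :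
    leastBelow c (fun i => ¬ (encSize a ++ R)[i]? = some true) = a := by
  refine (eq_leastBelow_iff.2 ⟨fun x hx => ?_, Or.inl ⟨hc, ?_⟩⟩).symm
  · simp [encSize, List.getElem?_append, hx]
  · simp [encSize]

@[simp] theorem firstSize_withSizes (a b : ℕ) (R : List Bool) :
    firstSize (withSizes a b R) = a :=
  leastBelow_encSize a _ (encSize b ++ R) (by simp [withSizes]; omega)

@[simp] theorem secondSize_withSizes (a b : ℕ) (R : List Bool) :
    secondSize (withSizes a b R) = b := by
  unfold secondSize
  rw [firstSize_withSizes]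
  simp only [withSizes, getElem?_append_add (length_encSize a)]
  exact leastBelow_encSize b _ R (by simp; omega)

@[simp] theorem restBit_withSizes (a b : ℕ) (R : List Bool) (i : ℕ) :
    restBit (withSizes a b R) i ↔ R[i]? = some true := by
  rw [restBit, firstSize_withSizes, secondSize_withSizes, withSizes,
    getElem?_append_add (length_encSize a), getElem?_append_add (length_encSize b)]

theorem withSizes_ne_nil (a b : ℕ) (R : List Bool) : withSizes a b R ≠ [] := by
  simp [withSizes, encSize]

theorem FAC0.withSizes (a b : List Bool → ℕ) (R : List Bool → List Bool)
    [AC0Fun fun X (_ : Fin 0 → ℕ) => a X] [AC0Fun fun X (_ : Fin 0 → ℕ) => b X] [FAC0 R] :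
    FAC0 fun X => withSizes (a X) (b X) (R X) := by
  unfold ComparatorCC.withSizes
  infer_instance

/-- A string of `n` blocks of length `c`, where bit `q` of block `k` is `1` iff `P k q`. -/
noncomputable def blocks (n c : ℕ) (P : ℕ → ℕ → Prop) : List Bool :=
  ofBits (n * c) fun p => P (p / c) (p % c)

theorem bit_blocks {n c k q : ℕ} (hk : k < n) (hq : q < c) (P : ℕ → ℕ → Prop) :
    (blocks n c P)[k * c + q]? = some true ↔ P k q := by
  have hc : 0 < c := by omega
  have hlt : k * c + q < n * c := by
    have := Nat.mul_le_mul_right c (Nat.succ_le_of_lt hk)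
    rw [Nat.succ_mul] at this
    omega
  rw [blocks, bit_ofBits, mul_comm k c, Nat.mul_add_div hc, Nat.mul_add_mod,
    Nat.div_eq_of_lt hq, Nat.mod_eq_of_lt hq, mul_comm c k]
  simp [hlt]

theorem blocks_congr {n c : ℕ} {P Q : ℕ → ℕ → Prop} (h : ∀ k < n, ∀ q < c, (P k q ↔ Q k q)) :
    blocks n c P = blocks n c Q := by
  refine ofBits_congr fun p hp => ?_
  have hc : 0 < c := Nat.pos_of_ne_zero (by rintro rfl; simp at hp)
  exact h _ ((Nat.div_lt_iff_lt_mul hc).2 hp) _ (Nat.mod_lt _ hc)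

theorem FAC0.blocks (n c : List Bool → ℕ) (P : List Bool → ℕ → ℕ → Prop)
    [AC0Fun fun X (_ : Fin 0 → ℕ) => n X] [AC0Fun fun X (_ : Fin 0 → ℕ) => c X]
    (hP : AC0Rel fun X (v : Fin 1 → ℕ) => P X (v 0 / c X) (v 0 % c X)) :
    FAC0 fun X => blocks (n X) (c X) (P X) :=
  FAC0.ofBits (fun X => n X * c X) _ (hP := hP)

/-! ### Presentations of problems by data over the natural numbers -/

/-- A presentation of a problem `P`: instances are given by data `C : D`, whose components are
functions and relations of natural numbers, without dependent types. `parse` reads the data off a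
string, and `Definable` says that a family of data, indexed by strings, has components in AC⁰. -/
structure Presentation (P : Language Bool) (D : Type) (Definable : (List Bool → D) → Prop) where
  /-- The data are those of an instance. -/
  Ok : D → Prop
  /-- The instance is positive. -/
  Val : D → Prop
  /-- The string for the instance. -/
  enc : D → List Bool
  /-- The data in a string. -/
  parse : List Bool → D
  enc_ne_nil : ∀ C, enc C ≠ []
  mem_iff : ∀ X, X ∈ P ↔ ∃ C, Ok C ∧ enc C = X ∧ Val C
  parse_enc : ∀ C, Ok C →
    Ok (parse (enc C)) ∧ enc (parse (enc C)) = enc C ∧ (Val (parse (enc C)) ↔ Val C)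
  definable_parse : Definable parse
  ok_ac0 : ∀ C, Definable C → AC0Rel fun X (_ : Fin 0 → ℕ) => Ok (C X)
  enc_fac0 : ∀ C, Definable C → FAC0 fun X => enc (C X)

namespace Presentation

variable {P Q : Language Bool} {D E : Type} {defD : (List Bool → D) → Prop}
  {defE : (List Bool → E) → Prop}

theorem enc_mem_iff (A : Presentation P D defD) {C : D} (hC : A.Ok C) :
    A.enc C ∈ P ↔ A.Val C := by
  rw [A.mem_iff]
  constructor
  · rintro ⟨C', hC', h, hv⟩
    rw [← (A.parse_enc C hC).2.2, ← h]
    exact (A.parse_enc C' hC').2.2.2 hv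
  · exact fun h => ⟨C, hC, rfl, h⟩

/-- The string `X` encodes an instance. This is expressed in AC⁰ by reading data off `X` and
encoding them again. -/
def Valid (A : Presentation P D defD) (X : List Bool) : Prop :=
  A.Ok (A.parse X) ∧ A.enc (A.parse X) = X

/-- A definable translation of the data, preserving the answer, is an AC⁰ reduction. -/
theorem reducible (A : Presentation P D defD) (B : Presentation Q E defE) (f : D → E)
    (hdef : ∀ C, defD C → defE fun X => f (C X))
    (hf : ∀ C, A.Ok C → B.Ok (f C) ∧ (B.Val (f C) ↔ A.Val C)) : AC0Reducible P Q := by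
  have h₁ := A.ok_ac0 _ A.definable_parse
  have h₂ := A.enc_fac0 _ A.definable_parse
  have h₃ := B.enc_fac0 _ (hdef _ A.definable_parse)
  have h₄ := AC0Rel.string_eq (fun X => A.enc (A.parse X)) fun X => X
  have h₅ : AC0Rel fun X (_ : Fin 0 → ℕ) => A.Valid X :=
    inferInstanceAs (AC0Rel fun X (_ : Fin 0 → ℕ) =>
      A.Ok (A.parse X) ∧ A.enc (A.parse X) = X)
  refine AC0Reducible.of_valid A.Valid (fun X => B.enc (f (A.parse X))) ?_ ?_ ?_
  · intro X hX
    obtain ⟨C, hC, rfl, -⟩ := (A.mem_iff X).1 hX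
    exact ⟨(A.parse_enc C hC).1, (A.parse_enc C hC).2.1⟩
  · rw [B.mem_iff]
    rintro ⟨C, -, h, -⟩
    exact B.enc_ne_nil C h
  · rintro X ⟨hX, hX'⟩
    rw [B.enc_mem_iff (hf _ hX).1, (hf _ hX).2, ← A.enc_mem_iff hX, hX']

end Presentation

theorem foldl_ofFn_induction {α β : Type*} {n : ℕ} (f : Fin n → α) (step : β → α → β) (b : β)
    (P : ℕ → β → Prop) (h₀ : P 0 b)
    (hs : ∀ k (h : k < n) b, P k b → P (k + 1) (step b (f ⟨k, h⟩))) :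
    P n ((List.ofFn f).foldl step b) := by
  induction n with
  | zero => simpa using h₀
  | succ n ih =>
    rw [List.ofFn_succ', List.concat_eq_append, List.foldl_append]
    exact hs n (Nat.lt_succ_self n) _
      (ih (fun i => f i.castSucc) fun k h b => hs k (h.trans (Nat.lt_succ_self n)) b)

/-! ### Circuits as data -/

/-- A comparator circuit with negation gates, with wires and gates numbered by natural numbers.
Gate `k` negates wire `fst k` if `kind k`, and otherwise it is the comparator
`(fst k, snd k)`. -/
structure RawCircuit where
  m : ℕ
  n : ℕ
  out : ℕ
  input : ℕ → Prop
  kind : ℕ → Prop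
  fst : ℕ → ℕ
  snd : ℕ → ℕ

namespace RawCircuit

open Classical in
/-- The set of the wires that carry `1` after the first `k` gates. -/
def state (C : RawCircuit) : ℕ → ℕ → Prop
  | 0, z => C.input z
  | k + 1, z =>
    if C.kind k then
      if z = C.fst k then ¬ C.state k z else C.state k z
    else if z = C.snd k then C.state k (C.fst k) ∨ C.state k (C.snd k)
    else if z = C.fst k then C.state k (C.fst k) ∧ C.state k (C.snd k)
    else C.state k z

/-- The output wire carries `1` at the end. -/
def Val (C : RawCircuit) : Prop :=
  C.state C.n C.out

/-- All wires that occur are below `m`. -/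
def Ok (C : RawCircuit) : Prop :=
  C.out < C.m ∧ ∀ k, k < C.n → C.fst k < C.m ∧ (¬ C.kind k → C.snd k < C.m)

/-- The data are `Ok`, and none of the gates is a negation gate. -/
def OkPos (C : RawCircuit) : Prop :=
  C.Ok ∧ ∀ k, k < C.n → ¬ C.kind k

/-- Two data describe the same circuit: they agree up to values that are never used. -/
structure Agrees (C D : RawCircuit) : Prop where
  m : D.m = C.m
  n : D.n = C.n
  out : D.out = C.out
  input : ∀ i < C.m, (D.input i ↔ C.input i)
  kind : ∀ k < C.n, (D.kind k ↔ C.kind k)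
  fst : ∀ k < C.n, D.fst k = C.fst k
  snd : ∀ k < C.n, ¬ C.kind k → D.snd k = C.snd k

/-- The string of a circuit without negation gates. -/
noncomputable def encPos (C : RawCircuit) : List Bool :=
  withSizes C.m C.n (ofBits C.m C.input ++ (ofBits C.m (fun i => i = C.out) ++
    blocks C.n (2 * C.m) fun k q => q = C.fst k ∨ q = C.m + C.snd k))

/-- The string of a circuit with negation gates. -/
noncomputable def encNeg (C : RawCircuit) : List Bool :=
  withSizes C.m C.n (ofBits C.m C.input ++ (ofBits C.m (fun i => i = C.out) ++
    blocks C.n (2 * C.m + 1) fun k q =>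
      q = 0 ∧ C.kind k ∨ q = C.fst k + 1 ∨ ¬ C.kind k ∧ q = C.m + (C.snd k + 1)))

/-- The circuit without negation gates in a string. -/
noncomputable def parsePos (X : List Bool) : RawCircuit where
  m := firstSize X
  n := secondSize X
  out := leastBelow (firstSize X) fun i => restBit X (firstSize X + i)
  input i := restBit X i
  kind _ := False
  fst k := leastBelow (firstSize X) fun i =>
    restBit X (firstSize X + (firstSize X + (k * (2 * firstSize X) + i)))
  snd k := leastBelow (firstSize X) fun i =>
    restBit X (firstSize X + (firstSize X + (k * (2 * firstSize X) + (firstSize X + i))))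

/-- The circuit with negation gates in a string. -/
noncomputable def parseNeg (X : List Bool) : RawCircuit where
  m := firstSize X
  n := secondSize X
  out := leastBelow (firstSize X) fun i => restBit X (firstSize X + i)
  input i := restBit X i
  kind k := restBit X (firstSize X + (firstSize X + (k * (2 * firstSize X + 1) + 0)))
  fst k := leastBelow (firstSize X) fun i =>
    restBit X (firstSize X + (firstSize X + (k * (2 * firstSize X + 1) + (i + 1))))
  snd k := leastBelow (firstSize X) fun i =>
    restBit X (firstSize X + (firstSize X + (k * (2 * firstSize X + 1) +
      (firstSize X + (i + 1)))))

theorem Agrees.ok {C D : RawCircuit} (h : C.Agrees D) (hC : C.Ok) : D.Ok := by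
  obtain ⟨h₁, h₂⟩ := hC
  refine ⟨by rwa [h.out, h.m], fun k hk => ?_⟩
  rw [h.n] at hk
  rw [h.fst k hk, h.m, h.kind k hk]
  refine ⟨(h₂ k hk).1, fun hn => ?_⟩
  rw [h.snd k hk hn]
  exact (h₂ k hk).2 hn

theorem Agrees.okPos {C D : RawCircuit} (h : C.Agrees D) (hC : C.OkPos) : D.OkPos := by
  refine ⟨h.ok hC.1, fun k hk => ?_⟩
  rw [h.n] at hk
  rw [h.kind k hk]
  exact hC.2 k hk

theorem Agrees.state {C D : RawCircuit} (h : C.Agrees D) (hC : C.Ok) :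
    ∀ k ≤ C.n, ∀ z < C.m, (D.state k z ↔ C.state k z)
  | 0, _, z, hz => h.input z hz
  | k + 1, hk, z, hz => by
    have ih := h.state hC k (by omega)
    have hk' : k < C.n := hk
    have h₁ := (hC.2 k hk').1
    by_cases hn : C.kind k
    · have hn' : D.kind k := (h.kind k hk').2 hn
      simp only [RawCircuit.state, hn, hn', if_true, h.fst k hk', ih z hz]
    · have hn' : ¬ D.kind k := (h.kind k hk').not.2 hn
      have h₂ := (hC.2 k hk').2 hn
      simp only [RawCircuit.state, hn, hn', if_false, h.fst k hk', h.snd k hk' hn, ih z hz,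
        ih _ h₁, ih _ h₂]

theorem Agrees.val {C D : RawCircuit} (h : C.Agrees D) (hC : C.Ok) : D.Val ↔ C.Val := by
  rw [Val, Val, h.n, h.out]
  exact h.state hC _ le_rfl _ hC.1

theorem Agrees.encPos {C D : RawCircuit} (h : C.Agrees D) (hC : C.OkPos) :
    D.encPos = C.encPos := by
  rw [RawCircuit.encPos, RawCircuit.encPos, h.m, h.n, h.out, ofBits_congr h.input]
  congr 3
  refine blocks_congr fun k hk q _ => ?_
  rw [h.fst k hk, h.snd k hk (hC.2 k hk)]

theorem Agrees.encNeg {C D : RawCircuit} (h : C.Agrees D) : D.encNeg = C.encNeg := by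
  rw [RawCircuit.encNeg, RawCircuit.encNeg, h.m, h.n, h.out, ofBits_congr h.input]
  congr 3
  refine blocks_congr fun k hk q _ => ?_
  rw [h.fst k hk, h.kind k hk]
  by_cases hn : C.kind k
  · simp [hn]
  · rw [h.snd k hk hn]

theorem agrees_parsePos {C : RawCircuit} (hC : C.OkPos) : C.Agrees (parsePos C.encPos) := by
  obtain ⟨⟨hout, hg⟩, hp⟩ := hC
  constructor
  · simp [parsePos, encPos]
  · simp [parsePos, encPos]
  · refine leastBelow_eq (by simpa [encPos] using hout) fun x hx => ?_
    simp only [encPos, firstSize_withSizes] at hx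
    simp only [encPos, firstSize_withSizes, restBit_withSizes, length_ofBits,
      getElem?_append_add, bit_append, bit_ofBits]
    simp [hx, hx.not_ge]
  · intro i hi
    simp [parsePos, encPos, bit_append, hi]
  · intro k hk
    simp [parsePos, hp k hk]
  · intro k hk
    have h₁ := (hg k hk).1
    refine leastBelow_eq (by simpa [encPos] using h₁) fun x hx => ?_
    simp only [encPos, firstSize_withSizes] at hx
    simp only [encPos, firstSize_withSizes, restBit_withSizes, length_ofBits,
      getElem?_append_add, bit_blocks hk (show x < 2 * C.m by omega)]
    omega
  · intro k hk hn
    have h₁ := (hg k hk).1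
    have h₂ := (hg k hk).2 hn
    refine leastBelow_eq (by simpa [encPos] using h₂) fun x hx => ?_
    simp only [encPos, firstSize_withSizes] at hx
    simp only [encPos, firstSize_withSizes, restBit_withSizes, length_ofBits,
      getElem?_append_add, bit_blocks hk (show C.m + x < 2 * C.m by omega)]
    omega

theorem agrees_parseNeg {C : RawCircuit} (hC : C.Ok) : C.Agrees (parseNeg C.encNeg) := by
  obtain ⟨hout, hg⟩ := hC
  constructor
  · simp [parseNeg, encNeg]
  · simp [parseNeg, encNeg]
  · refine leastBelow_eq (by simpa [encNeg] using hout) fun x hx => ?_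
    simp only [encNeg, firstSize_withSizes] at hx
    simp only [encNeg, firstSize_withSizes, restBit_withSizes, length_ofBits,
      getElem?_append_add, bit_append, bit_ofBits]
    simp [hx, hx.not_ge]
  · intro i hi
    simp [parseNeg, encNeg, bit_append, hi]
  · intro k hk
    simp only [parseNeg, encNeg, firstSize_withSizes, restBit_withSizes, length_ofBits,
      getElem?_append_add, bit_blocks hk (show 0 < 2 * C.m + 1 by omega)]
    have h₁ := (hg k hk).1
    have : 0 ≠ C.m + (C.snd k + 1) := by omega
    simp [this]
  · intro k hk
    have h₁ := (hg k hk).1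
    refine leastBelow_eq (by simpa [encNeg] using h₁) fun x hx => ?_
    simp only [encNeg, firstSize_withSizes] at hx
    simp only [encNeg, firstSize_withSizes, restBit_withSizes, length_ofBits,
      getElem?_append_add, bit_blocks hk (show x + 1 < 2 * C.m + 1 by omega)]
    omega
  · intro k hk hn
    have h₁ := (hg k hk).1
    have h₂ := (hg k hk).2 hn
    refine leastBelow_eq (by simpa [encNeg] using h₂) fun x hx => ?_
    simp only [encNeg, firstSize_withSizes] at hx
    simp only [encNeg, firstSize_withSizes, restBit_withSizes, length_ofBits,
      getElem?_append_add, bit_blocks hk (show C.m + (x + 1) < 2 * C.m + 1 by omega)]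
    simp only [hn, not_false_eq_true, true_and, and_false, false_or]
    omega

/-- The components of a family of circuits are in AC⁰, in each context of `k` number variables. -/
class Definable (C : List Bool → RawCircuit) : Prop where
  m : ∀ k, AC0Fun fun X (_ : Fin k → ℕ) => (C X).m
  n : ∀ k, AC0Fun fun X (_ : Fin k → ℕ) => (C X).n
  out : ∀ k, AC0Fun fun X (_ : Fin k → ℕ) => (C X).out
  input : ∀ k (f : List Bool → (Fin k → ℕ) → ℕ) [AC0Fun f],
    AC0Rel fun X v => (C X).input (f X v)
  kind : ∀ k (f : List Bool → (Fin k → ℕ) → ℕ) [AC0Fun f],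
    AC0Rel fun X v => (C X).kind (f X v)
  fst : ∀ k (f : List Bool → (Fin k → ℕ) → ℕ) [AC0Fun f],
    AC0Fun fun X v => (C X).fst (f X v)
  snd : ∀ k (f : List Bool → (Fin k → ℕ) → ℕ) [AC0Fun f],
    AC0Fun fun X v => (C X).snd (f X v)

attribute [instance] Definable.m Definable.n Definable.out Definable.input Definable.kind
  Definable.fst Definable.snd

instance : Definable parsePos := by
  constructor <;> intros <;> simp only [parsePos] <;> infer_instance

instance : Definable parseNeg := by
  constructor <;> intros <;> simp only [parseNeg] <;> infer_instance

instance Definable.ok (C : List Bool → RawCircuit) [Definable C] {k : ℕ} :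
    AC0Rel fun X (_ : Fin k → ℕ) => (C X).Ok := by
  unfold Ok
  infer_instance

instance Definable.okPos (C : List Bool → RawCircuit) [Definable C] {k : ℕ} :
    AC0Rel fun X (_ : Fin k → ℕ) => (C X).OkPos := by
  unfold OkPos
  infer_instance

theorem Definable.encPos (C : List Bool → RawCircuit) [Definable C] :
    FAC0 fun X => (C X).encPos := by
  have h₁ := FAC0.ofBits (fun X => (C X).m) fun X => (C X).input
  have h₂ := FAC0.ofBits (fun X => (C X).m) fun X i => i = (C X).out
  have h₃ : FAC0 fun X => blocks (C X).n (2 * (C X).m) fun k q =>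
      q = (C X).fst k ∨ q = (C X).m + (C X).snd k := FAC0.blocks _ _ _ inferInstance
  exact FAC0.withSizes _ _ _

theorem Definable.encNeg (C : List Bool → RawCircuit) [Definable C] :
    FAC0 fun X => (C X).encNeg := by
  have h₁ := FAC0.ofBits (fun X => (C X).m) fun X => (C X).input
  have h₂ := FAC0.ofBits (fun X => (C X).m) fun X i => i = (C X).out
  have h₃ : FAC0 fun X => blocks (C X).n (2 * (C X).m + 1) fun k q =>
      q = 0 ∧ (C X).kind k ∨ q = (C X).fst k + 1 ∨
        ¬ (C X).kind k ∧ q = (C X).m + ((C X).snd k + 1) := FAC0.blocks _ _ _ inferInstance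
  exact FAC0.withSizes _ _ _

end RawCircuit

/-! ### The circuit value problems, presented by data -/

namespace RawCircuit

open Classical in
/-- The instance of the circuit value problem given by data without negation gates. -/
noncomputable def toCcv (C : RawCircuit) (h : C.OkPos) : CcvInstance where
  m := C.m
  input i := decide (C.input i)
  gates := List.ofFn fun k : Fin C.n =>
    (⟨C.fst k, (h.1.2 k k.2).1⟩, ⟨C.snd k, (h.1.2 k k.2).2 (h.2 k k.2)⟩)
  out := ⟨C.out, h.1.1⟩

open Classical in
/-- The instance of the circuit value problem with negation gates given by data. -/
noncomputable def toCcvNeg (C : RawCircuit) (h : C.Ok) : CcvNegInstance where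
  m := C.m
  input i := decide (C.input i)
  gates := List.ofFn fun k : Fin C.n =>
    if hk : C.kind k then .neg ⟨C.fst k, (h.2 k k.2).1⟩
    else .comp ⟨C.fst k, (h.2 k k.2).1⟩ ⟨C.snd k, (h.2 k k.2).2 hk⟩
  out := ⟨C.out, h.1⟩

theorem comparator_apply {m : ℕ} (i j z : Fin m) (w : Fin m → Bool) :
    comparator i j w z = if z = j then w i || w j else if z = i then w i && w j else w z := by
  simp [comparator, Function.update_apply]

theorem output_toCcv (C : RawCircuit) (h : C.OkPos) :
    ∀ z : Fin C.m, (C.toCcv h).output z = true ↔ C.state C.n z := by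
  refine foldl_ofFn_induction _ _ _
    (fun k (w : Fin C.m → Bool) => ∀ z : Fin C.m, w z = true ↔ C.state k z) ?_ ?_
  · intro z
    simp [toCcv, state]
  · intro k hk w ih z
    have h₁ := ih ⟨C.fst k, (h.1.2 k hk).1⟩
    have h₂ := ih ⟨C.snd k, (h.1.2 k hk).2 (h.2 k hk)⟩
    change comparator (m := C.m) ⟨C.fst k, (h.1.2 k hk).1⟩
      ⟨C.snd k, (h.1.2 k hk).2 (h.2 k hk)⟩ w z = true ↔ C.state (k + 1) z
    simp only [comparator_apply, state, if_neg (h.2 k hk), Fin.ext_iff]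
    split_ifs
    · simp [h₁, h₂]
    · simp [h₁, h₂]
    · exact ih z

theorem output_toCcvNeg (C : RawCircuit) (h : C.Ok) :
    ∀ z : Fin C.m, (C.toCcvNeg h).output z = true ↔ C.state C.n z := by
  classical
  refine foldl_ofFn_induction _ _ _
    (fun k (w : Fin C.m → Bool) => ∀ z : Fin C.m, w z = true ↔ C.state k z) ?_ ?_
  · intro z
    simp [toCcvNeg, state]
  · intro k hk w ih z
    have h₁ := ih ⟨C.fst k, (h.2 k hk).1⟩
    change GateNeg.apply (m := C.m) (if hn : C.kind k then .neg ⟨C.fst k, (h.2 k hk).1⟩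
      else .comp ⟨C.fst k, (h.2 k hk).1⟩ ⟨C.snd k, (h.2 k hk).2 hn⟩) w z = true ↔
        C.state (k + 1) z
    by_cases hn : C.kind k
    · simp only [hn, dif_pos, GateNeg.apply, state, if_true, Function.update_apply, Fin.ext_iff]
      split_ifs with hz
      · simp [← h₁, hz]
      · exact ih z
    · have h₂ := ih ⟨C.snd k, (h.2 k hk).2 hn⟩
      simp only [hn, dif_neg, not_false_eq_true, GateNeg.apply, comparator_apply, state, if_false,
        Fin.ext_iff]
      split_ifs
      · simp [h₁, h₂]
      · simp [h₁, h₂]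
      · exact ih z

theorem encode_toCcv (C : RawCircuit) (h : C.OkPos) : (C.toCcv h).encode = C.encPos := by
  simp only [CcvInstance.encode, toCcv, encPos, withSizes, List.append_assoc, List.length_ofFn,
    encIndex_eq_ofBits]
  rw [ofFn_eq_ofBits _ C.input fun i => by simp]
  congr 4
  refine flatMap_ofFn_eq_ofBits (2 * C.m) C.n _ _
    (fun k q => q = C.fst k ∨ q = C.m + C.snd k) fun k => ?_
  have h₁ := (h.1.2 k k.2).1
  have h₂ := (h.1.2 k k.2).2 (h.2 k k.2)
  simp only [ofBits_append, ← two_mul]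
  refine ofBits_congr fun q hq => ?_
  split_ifs <;> omega

theorem encode_toCcvNeg (C : RawCircuit) (h : C.Ok) : (C.toCcvNeg h).encode = C.encNeg := by
  simp only [CcvNegInstance.encode, toCcvNeg, encNeg, withSizes, List.append_assoc,
    List.length_ofFn, encIndex_eq_ofBits]
  rw [ofFn_eq_ofBits _ C.input fun i => by simp]
  congr 4
  refine flatMap_ofFn_eq_ofBits (2 * C.m + 1) C.n _ _
    (fun k q => q = 0 ∧ C.kind k ∨ q = C.fst k + 1 ∨ ¬ C.kind k ∧ q = C.m + (C.snd k + 1))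
    fun k => ?_
  have h₁ := (h.2 k k.2).1
  have hcons (b : Bool) (A : List Bool) : b :: A = ofBits 1 (fun _ => b = true) ++ A := by
    cases b <;> simp [ofBits]
  have hrep : List.replicate C.m false = ofBits C.m fun _ => False := by simp [ofBits]
  by_cases hn : C.kind k
  · simp only [hn, dif_pos, GateNeg.encode, encIndex_eq_ofBits, hrep, ofBits_append]
    rw [hcons, ofBits_append]
    rw [show 1 + (C.m + C.m) = 2 * C.m + 1 by omega]
    refine ofBits_congr fun q hq => ?_
    simp only [not_true_eq_false, false_and, or_false, and_true]
    split_ifs <;> (try simp) <;> omega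
  · have h₂ := (h.2 k k.2).2 hn
    simp only [hn, dif_neg, not_false_eq_true, GateNeg.encode, encIndex_eq_ofBits, ofBits_append]
    rw [hcons, ofBits_append]
    rw [show 1 + (C.m + C.m) = 2 * C.m + 1 by omega]
    refine ofBits_congr fun q hq => ?_
    simp only [and_false, false_or, true_and]
    split_ifs <;> (try simp) <;> omega

theorem exists_toCcv (I : CcvInstance) : ∃ (C : RawCircuit) (h : C.OkPos), C.toCcv h = I := by
  obtain ⟨m, input, gates, out⟩ := I
  obtain ⟨n, g, rfl⟩ : ∃ (n : ℕ) (g : Fin n → Fin m × Fin m), gates = List.ofFn g :=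
    ⟨_, _, (List.ofFn_get gates).symm⟩
  refine ⟨⟨m, n, out, fun i => ∃ h : i < m, input ⟨i, h⟩ = true, fun _ => False,
    fun k => if h : k < n then (g ⟨k, h⟩).1 else 0,
    fun k => if h : k < n then (g ⟨k, h⟩).2 else 0⟩,
    ⟨⟨out.2, fun k hk => by simp [show k < n from hk]⟩, fun _ _ h => h⟩, ?_⟩
  simp [toCcv]

/-- Whether a gate is a negation gate. -/
def _root_.ComparatorCC.GateNeg.IsNeg {m : ℕ} : GateNeg m → Prop
  | .comp _ _ => False
  | .neg _ => True

/-- The first wire of a gate. -/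
def _root_.ComparatorCC.GateNeg.fstWire {m : ℕ} : GateNeg m → Fin m
  | .comp i _ => i
  | .neg i => i

/-- The second wire of a comparator gate; for a negation gate, a value that is not used. -/
def _root_.ComparatorCC.GateNeg.sndWire {m : ℕ} : GateNeg m → Fin m
  | .comp _ j => j
  | .neg i => i

theorem exists_toCcvNeg (I : CcvNegInstance) :
    ∃ (C : RawCircuit) (h : C.Ok), C.toCcvNeg h = I := by
  obtain ⟨m, input, gates, out⟩ := I
  obtain ⟨n, g, rfl⟩ : ∃ (n : ℕ) (g : Fin n → GateNeg m), gates = List.ofFn g :=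
    ⟨_, _, (List.ofFn_get gates).symm⟩
  refine ⟨⟨m, n, out, fun i => ∃ h : i < m, input ⟨i, h⟩ = true,
    fun k => ∃ h : k < n, (g ⟨k, h⟩).IsNeg,
    fun k => if h : k < n then (g ⟨k, h⟩).fstWire else 0,
    fun k => if h : k < n then (g ⟨k, h⟩).sndWire else 0⟩,
    ⟨out.2, fun k hk => by simp [show k < n from hk]⟩, ?_⟩
  simp only [toCcvNeg, Fin.is_lt, exists_true_left, Fin.eta, Bool.decide_eq_true, dif_pos]
  congr 2
  funext k
  obtain ⟨x, hx⟩ : ∃ x, g k = x := ⟨_, rfl⟩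
  cases x <;> simp [hx, GateNeg.IsNeg, GateNeg.fstWire, GateNeg.sndWire]

theorem mem_Ccv_iff (X : List Bool) :
    X ∈ Ccv ↔ ∃ C : RawCircuit, C.OkPos ∧ C.encPos = X ∧ C.Val := by
  constructor
  · rintro ⟨I, rfl, h⟩
    obtain ⟨C, hC, rfl⟩ := exists_toCcv I
    exact ⟨C, hC, (encode_toCcv C hC).symm, (output_toCcv C hC _).1 h⟩
  · rintro ⟨C, hC, rfl, h⟩
    exact ⟨C.toCcv hC, encode_toCcv C hC, (output_toCcv C hC ⟨C.out, hC.1.1⟩).2 h⟩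

theorem mem_CcvNeg_iff (X : List Bool) :
    X ∈ CcvNeg ↔ ∃ C : RawCircuit, C.Ok ∧ C.encNeg = X ∧ C.Val := by
  constructor
  · rintro ⟨I, rfl, h⟩
    obtain ⟨C, hC, rfl⟩ := exists_toCcvNeg I
    exact ⟨C, hC, (encode_toCcvNeg C hC).symm, (output_toCcvNeg C hC _).1 h⟩
  · rintro ⟨C, hC, rfl, h⟩
    exact ⟨C.toCcvNeg hC, encode_toCcvNeg C hC, (output_toCcvNeg C hC ⟨C.out, hC.1⟩).2 h⟩

/-- The circuit value problem, presented by data. -/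
noncomputable def ccvPresentation : Presentation Ccv RawCircuit Definable where
  Ok := OkPos
  Val := Val
  enc := encPos
  parse := parsePos
  enc_ne_nil _ := withSizes_ne_nil _ _ _
  mem_iff := mem_Ccv_iff
  parse_enc _ hC :=
    have h := agrees_parsePos hC
    ⟨h.okPos hC, h.encPos hC, h.val hC.1⟩
  definable_parse := inferInstance
  ok_ac0 C _ := Definable.okPos C
  enc_fac0 C _ := Definable.encPos C

/-- The circuit value problem with negation gates, presented by data. -/
noncomputable def ccvNegPresentation : Presentation CcvNeg RawCircuit Definable where
  Ok := Ok
  Val := Val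
  enc := encNeg
  parse := parseNeg
  enc_ne_nil _ := withSizes_ne_nil _ _ _
  mem_iff := mem_CcvNeg_iff
  parse_enc _ hC :=
    have h := agrees_parseNeg hC
    ⟨h.ok hC, h.encNeg, h.val hC⟩
  definable_parse := inferInstance
  ok_ac0 C _ := Definable.ok C
  enc_fac0 C _ := Definable.encNeg C

end RawCircuit

/-! ### Bipartite graphs as data -/

/-- A bipartite graph with `m` bottom and `n` top nodes, numbered by natural numbers, with a
designated bottom node `bot` and a designated top node `top`. -/
structure RawGraph where
  m : ℕ
  n : ℕ
  bot : ℕ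
  top : ℕ
  adj : ℕ → ℕ → Prop

namespace RawGraph

/-- The set of the top nodes that are matched when it is the turn of the bottom node `v`. -/
def Matched (G : RawGraph) : ℕ → ℕ → Prop
  | 0, _ => False
  | v + 1, w => G.Matched v w ∨
      w < G.n ∧ G.adj v w ∧ ¬ G.Matched v w ∧ ∀ w', w' < w → G.adj v w' → G.Matched v w'

/-- The bottom node `v` is matched to the top node `w`. -/
def Chosen (G : RawGraph) (v w : ℕ) : Prop :=
  w < G.n ∧ G.adj v w ∧ ¬ G.Matched v w ∧ ∀ w', w' < w → G.adj v w' → G.Matched v w'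

theorem matched_succ {G : RawGraph} {v w : ℕ} :
    G.Matched (v + 1) w ↔ G.Matched v w ∨ G.Chosen v w :=
  Iff.rfl

theorem matched_iff {G : RawGraph} {v w : ℕ} : G.Matched v w ↔ ∃ u < v, G.Chosen u w := by
  induction v with
  | zero => simp [Matched]
  | succ v ih =>
    rw [matched_succ, ih]
    constructor
    · rintro (⟨u, hu, h⟩ | h)
      · exact ⟨u, hu.trans (Nat.lt_succ_self v), h⟩
      · exact ⟨v, Nat.lt_succ_self v, h⟩
    · rintro ⟨u, hu, h⟩
      rcases Nat.lt_succ_iff_lt_or_eq.1 hu with hu | rfl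
      · exact Or.inl ⟨u, hu, h⟩
      · exact Or.inr h

theorem Chosen.unique {G : RawGraph} {v w w' : ℕ} (h : G.Chosen v w) (h' : G.Chosen v w') :
    w = w' := by
  rcases lt_trichotomy w w' with hlt | heq | hlt
  · exact absurd (h'.2.2.2 w hlt h.2.1) h.2.2.1
  · exact heq
  · exact absurd (h.2.2.2 w' hlt h'.2.1) h'.2.2.1

/-- All nodes have at most three neighbours. Counting is not available in AC⁰, so that three nodes
that cover the neighbours are quantified instead; they may be equal, and the bound exceeds the
number of nodes so that they exist even if there are no nodes. -/
def DegLe (G : RawGraph) : Prop :=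
  (∀ v, v < G.m → ∃ a, a < G.n + 1 ∧ ∃ b, b < G.n + 1 ∧ ∃ c, c < G.n + 1 ∧
    ∀ w, w < G.n → G.adj v w → w = a ∨ w = b ∨ w = c) ∧
  ∀ w, w < G.n → ∃ a, a < G.m + 1 ∧ ∃ b, b < G.m + 1 ∧ ∃ c, c < G.m + 1 ∧
    ∀ v, v < G.m → G.adj v w → v = a ∨ v = b ∨ v = c

/-- Two data describe the same graph. -/
structure Agrees (G H : RawGraph) : Prop where
  m : H.m = G.m
  n : H.n = G.n
  adj : ∀ v < G.m, ∀ w < G.n, (H.adj v w ↔ G.adj v w)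

theorem Agrees.degLe {G H : RawGraph} (h : G.Agrees H) (hG : G.DegLe) : H.DegLe := by
  obtain ⟨h₁, h₂⟩ := hG
  constructor
  · intro v hv
    rw [h.m] at hv
    obtain ⟨a, ha, b, hb, c, hc, habc⟩ := h₁ v hv
    rw [h.n]
    exact ⟨a, ha, b, hb, c, hc, fun w hw hvw => habc w hw ((h.adj v hv w hw).1 hvw)⟩
  · intro w hw
    rw [h.n] at hw
    obtain ⟨a, ha, b, hb, c, hc, habc⟩ := h₂ w hw
    rw [h.m]
    exact ⟨a, ha, b, hb, c, hc, fun v hv hvw => habc v hv ((h.adj v hv w hw).1 hvw)⟩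

theorem Agrees.chosen_of {G H : RawGraph} (h : G.Agrees H) {v : ℕ} (hv : v < G.m)
    (ih : ∀ w < G.n, (H.Matched v w ↔ G.Matched v w)) {w : ℕ} (hw : w < G.n) :
    H.Chosen v w ↔ G.Chosen v w := by
  unfold Chosen
  rw [h.n, h.adj v hv w hw, ih w hw]
  refine and_congr_right fun _ => and_congr_right fun _ => and_congr_right fun _ =>
    forall_congr' fun w' => forall_congr' fun hw' => ?_
  rw [h.adj v hv w' (hw'.trans hw), ih w' (hw'.trans hw)]

theorem Agrees.matched {G H : RawGraph} (h : G.Agrees H) :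
    ∀ v ≤ G.m, ∀ w < G.n, (H.Matched v w ↔ G.Matched v w)
  | 0, _, _, _ => Iff.rfl
  | v + 1, hv, w, hw => by
    have ih := h.matched v (by omega)
    rw [matched_succ, matched_succ, ih w hw, h.chosen_of hv ih hw]

theorem Agrees.chosen {G H : RawGraph} (h : G.Agrees H) {v w : ℕ} (hv : v < G.m)
    (hw : w < G.n) : H.Chosen v w ↔ G.Chosen v w :=
  h.chosen_of hv (h.matched v hv.le) hw

open Classical in
/-- The graph given by data. -/
noncomputable def toBipGraph (G : RawGraph) : BipGraph where
  m := G.m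
  n := G.n
  adj v w := decide (G.adj v w)

theorem exists_toBipGraph (H : BipGraph) (bot top : ℕ) :
    ∃ G : RawGraph, G.bot = bot ∧ G.top = top ∧ G.toBipGraph = H := by
  obtain ⟨m, n, adj⟩ := H
  refine ⟨⟨m, n, bot, top, fun v w => ∃ (hv : v < m) (hw : w < n), adj ⟨v, hv⟩ ⟨w, hw⟩ = true⟩,
    rfl, rfl, ?_⟩
  simp [toBipGraph]

theorem encode_toBipGraph (G : RawGraph) :
    G.toBipGraph.encode = withSizes G.m G.n (blocks G.m G.n G.adj) := by
  simp only [BipGraph.encode, toBipGraph, withSizes, List.append_assoc]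
  congr 2
  rw [← List.ofFn_id]
  exact flatMap_ofFn_eq_ofBits _ _ _ _ G.adj fun v => ofFn_eq_ofBits _ _ fun w => by simp

theorem find?_finRange_eq_some {n : ℕ} {p : Fin n → Bool} {w : Fin n} :
    (List.finRange n).find? p = some w ↔ p w = true ∧ ∀ w' < w, p w' = false := by
  rw [List.find?_eq_some_iff_getElem]
  simp only [List.getElem_finRange, List.length_finRange, Bool.not_eq_true']
  refine and_congr_right fun _ => ⟨?_, fun h => ?_⟩
  · rintro ⟨i, hi, rfl, h⟩ w' hw'
    exact h w' hw'
  · exact ⟨w, w.2, rfl, fun j hj => h _ hj⟩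

theorem lfmStep_of_find?_eq_some {H : BipGraph} {M : List (Fin H.m × Fin H.n)} {v : Fin H.m}
    {w : Fin H.n} (h : ((List.finRange H.n).find? fun w =>
      H.adj v w && !(M.map Prod.snd).contains w) = some w) :
    H.lfmStep M v = M ++ [(v, w)] := by
  simp only [BipGraph.lfmStep, h]

theorem lfmStep_of_find?_eq_none {H : BipGraph} {M : List (Fin H.m × Fin H.n)} {v : Fin H.m}
    (h : ((List.finRange H.n).find? fun w =>
      H.adj v w && !(M.map Prod.snd).contains w) = none) :
    H.lfmStep M v = M := by
  simp only [BipGraph.lfmStep, h]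

theorem mem_lfm_iff (G : RawGraph) (v : Fin G.m) (w : Fin G.n) :
    (v, w) ∈ G.toBipGraph.lfm ↔ G.Chosen v w := by
  classical
  have key := foldl_ofFn_induction (id : Fin G.m → Fin G.m) G.toBipGraph.lfmStep []
    (fun k (M : List (Fin G.m × Fin G.n)) =>
      ∀ v w, (v, w) ∈ M ↔ (v : ℕ) < k ∧ G.Chosen v w) ?_ ?_
  · have := key v w
    simp only [List.ofFn_id, Fin.is_lt, true_and] at this
    exact this
  · intro v w
    change (v, w) ∈ ([] : List (Fin G.m × Fin G.n)) ↔ _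
    simp
  · intro k hk M ih
    change List (Fin G.m × Fin G.n) at M
    have hM (w : Fin G.n) : (M.map Prod.snd).contains w = true ↔ G.Matched k w := by
      rw [matched_iff]
      simp only [List.contains_eq_mem, List.mem_map, Prod.exists, exists_eq_right, ih,
        decide_eq_true_eq]
      exact ⟨fun ⟨u, hu, h⟩ => ⟨u, hu, h⟩, fun ⟨u, hu, h⟩ => ⟨⟨u, hu.trans hk⟩, hu, h⟩⟩
    have hfind (w : Fin G.n) : ((List.finRange G.n).find? fun w : Fin G.n =>
        decide (G.adj k w) && !(M.map Prod.snd).contains w) = some w ↔ G.Chosen k w := by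
      rw [find?_finRange_eq_some]
      simp only [Bool.and_eq_true, decide_eq_true_eq, Bool.not_eq_true', ← Bool.not_eq_true, hM,
        not_and, not_not]
      constructor
      · rintro ⟨⟨h₁, h₂⟩, h₃⟩
        exact ⟨w.2, h₁, h₂, fun w' hw' h => h₃ ⟨w', hw'.trans w.2⟩ hw' h⟩
      · rintro ⟨-, h₁, h₂, h₃⟩
        exact ⟨⟨h₁, h₂⟩, fun w' hw' h => h₃ w' hw' h⟩
    intro v w
    rcases h₀ : (List.finRange G.n).find? fun w : Fin G.n =>
        decide (G.adj k w) && !(M.map Prod.snd).contains w with _ | w₀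
    · have hstep : G.toBipGraph.lfmStep M (id ⟨k, hk⟩) = M := lfmStep_of_find?_eq_none h₀
      refine (iff_of_eq (congrArg (fun L : List (Fin G.m × Fin G.n) => (v, w) ∈ L) hstep)).trans ?_
      rw [ih]
      refine ⟨fun ⟨h, h'⟩ => ⟨by omega, h'⟩, fun ⟨h, h'⟩ => ⟨?_, h'⟩⟩
      rcases Nat.lt_succ_iff_lt_or_eq.1 h with h | h
      · exact h
      · rw [h] at h'
        rw [(hfind w).2 h'] at h₀
        cases h₀
    · have hstep : G.toBipGraph.lfmStep M (id ⟨k, hk⟩) = M ++ [(⟨k, hk⟩, w₀)] :=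
        lfmStep_of_find?_eq_some h₀
      have hw₀ := (hfind w₀).1 h₀
      refine (iff_of_eq (congrArg (fun L : List (Fin G.m × Fin G.n) => (v, w) ∈ L) hstep)).trans ?_
      change (v, w) ∈ M ++ [((⟨k, hk⟩ : Fin G.m), w₀)] ↔ _
      simp only [List.mem_append, ih, List.mem_singleton, Prod.mk.injEq, Fin.ext_iff]
      constructor
      · rintro (⟨h, h'⟩ | ⟨h, h'⟩)
        · exact ⟨by omega, h'⟩
        · rw [h, h']
          exact ⟨by omega, hw₀⟩
      · rintro ⟨h, h'⟩
        rcases Nat.lt_succ_iff_lt_or_eq.1 h with h | h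
        · exact Or.inl ⟨h, h'⟩
        · rw [h] at h'
          exact Or.inr ⟨h, h'.unique hw₀⟩

theorem exists_covering_of_card_le_three {s : Finset ℕ} (h : s.card ≤ 3) {n : ℕ}
    (hs : ∀ x ∈ s, x < n) :
    ∃ a, a < n + 1 ∧ ∃ b, b < n + 1 ∧ ∃ c, c < n + 1 ∧ ∀ w ∈ s, w = a ∨ w = b ∨ w = c := by
  have hs' : ∀ x ∈ s, x < n + 1 := fun x hx => (hs x hx).trans (Nat.lt_succ_self n)
  obtain h | h | h | h : s.card = 0 ∨ s.card = 1 ∨ s.card = 2 ∨ s.card = 3 := by omega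
  · rw [Finset.card_eq_zero] at h
    exact ⟨0, by omega, 0, by omega, 0, by omega, by simp [h]⟩
  · obtain ⟨a, rfl⟩ := Finset.card_eq_one.1 h
    have ha := hs' a (by simp)
    exact ⟨a, ha, a, ha, a, ha, by simp⟩
  · obtain ⟨a, b, -, rfl⟩ := Finset.card_eq_two.1 h
    exact ⟨a, hs' a (by simp), b, hs' b (by simp), b, hs' b (by simp), by simp⟩
  · obtain ⟨a, b, c, -, -, -, rfl⟩ := Finset.card_eq_three.1 h
    exact ⟨a, hs' a (by simp), b, hs' b (by simp), c, hs' c (by simp), by simp⟩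

theorem card_filter_le_three_iff {n : ℕ} (p : Fin n → Prop) {_ : DecidablePred p} (P : ℕ → Prop)
    (hP : ∀ w : Fin n, p w ↔ P w) :
    (Finset.univ.filter p).card ≤ 3 ↔
      ∃ a, a < n + 1 ∧ ∃ b, b < n + 1 ∧ ∃ c, c < n + 1 ∧
        ∀ w, w < n → P w → w = a ∨ w = b ∨ w = c := by
  rw [← Finset.card_map Fin.valEmbedding]
  constructor
  · intro h
    obtain ⟨a, ha, b, hb, c, hc, habc⟩ :=
      exists_covering_of_card_le_three h (n := n) (by simp)
    refine ⟨a, ha, b, hb, c, hc, fun w hw hPw => habc w ?_⟩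
    simp only [Finset.mem_map, Finset.mem_filter, Finset.mem_univ, true_and]
    exact ⟨⟨w, hw⟩, (hP _).2 hPw, rfl⟩
  · rintro ⟨a, -, b, -, c, -, habc⟩
    refine (Finset.card_le_card (t := {a, b, c}) fun x hx => ?_).trans Finset.card_le_three
    simp only [Finset.mem_map, Finset.mem_filter, Finset.mem_univ, true_and] at hx
    obtain ⟨w, hw, rfl⟩ := hx
    simpa using habc w w.2 ((hP w).1 hw)

theorem degLeThree_toBipGraph (G : RawGraph) : G.toBipGraph.DegLeThree ↔ G.DegLe := by
  refine and_congr ⟨fun h v hv => ?_, fun h v => ?_⟩ ⟨fun h w hw => ?_, fun h w => ?_⟩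
  · exact (card_filter_le_three_iff _ (G.adj v) fun w => by simp [toBipGraph]).1 (h ⟨v, hv⟩)
  · exact (card_filter_le_three_iff _ (G.adj v) fun w => by simp [toBipGraph]).2 (h v v.2)
  · exact (card_filter_le_three_iff _ (fun v => G.adj v w)
      fun w => by simp [toBipGraph]).1 (h ⟨w, hw⟩)
  · exact (card_filter_le_three_iff _ (fun v => G.adj v w)
      fun w => by simp [toBipGraph]).2 (h w w.2)

/-- The components of a family of graphs are in AC⁰, in each context of `k` number variables. -/
class Definable (G : List Bool → RawGraph) : Prop where
  m : ∀ k, AC0Fun fun X (_ : Fin k → ℕ) => (G X).m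
  n : ∀ k, AC0Fun fun X (_ : Fin k → ℕ) => (G X).n
  bot : ∀ k, AC0Fun fun X (_ : Fin k → ℕ) => (G X).bot
  top : ∀ k, AC0Fun fun X (_ : Fin k → ℕ) => (G X).top
  adj : ∀ k (f g : List Bool → (Fin k → ℕ) → ℕ) [AC0Fun f] [AC0Fun g],
    AC0Rel fun X v => (G X).adj (f X v) (g X v)

attribute [instance] Definable.m Definable.n Definable.bot Definable.top Definable.adj

instance Definable.degLe (G : List Bool → RawGraph) [Definable G] {k : ℕ} :
    AC0Rel fun X (_ : Fin k → ℕ) => (G X).DegLe := by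
  unfold DegLe
  infer_instance

/-! ### The matching problems, presented by data

In the next declarations, the proposition `b` tells whether the degrees are restricted. -/

/-- The data form an instance of the vertex problem. -/
def OkV (b : Prop) (G : RawGraph) : Prop :=
  G.top < G.n ∧ (b → G.DegLe)

/-- The data form an instance of the edge problem. -/
def OkE (b : Prop) (G : RawGraph) : Prop :=
  (G.bot < G.m ∧ G.top < G.n ∧ G.adj G.bot G.top) ∧ (b → G.DegLe)

/-- The string of an instance of the vertex problem. -/
noncomputable def encV (G : RawGraph) : List Bool :=
  withSizes G.m G.n (blocks G.m G.n G.adj ++ ofBits G.n fun i => i = G.top)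

/-- The string of an instance of the edge problem. -/
noncomputable def encE (G : RawGraph) : List Bool :=
  withSizes G.m G.n (blocks G.m G.n G.adj ++
    (ofBits G.m (fun i => i = G.bot) ++ ofBits G.n fun i => i = G.top))

/-- The graph with a designated top node in a string. -/
noncomputable def parseV (X : List Bool) : RawGraph where
  m := firstSize X
  n := secondSize X
  bot := 0
  top := leastBelow (secondSize X) fun i => restBit X (firstSize X * secondSize X + i)
  adj v w := restBit X (v * secondSize X + w)

/-- The graph with a designated edge in a string. -/
noncomputable def parseE (X : List Bool) : RawGraph where
  m := firstSize X
  n := secondSize X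
  bot := leastBelow (firstSize X) fun i => restBit X (firstSize X * secondSize X + i)
  top := leastBelow (secondSize X) fun i =>
    restBit X (firstSize X * secondSize X + (firstSize X + i))
  adj v w := restBit X (v * secondSize X + w)

instance : Definable parseV := by
  constructor <;> intros <;> simp only [parseV] <;> infer_instance

instance : Definable parseE := by
  constructor <;> intros <;> simp only [parseE] <;> infer_instance

@[simp] theorem length_blocks (n c : ℕ) (P : ℕ → ℕ → Prop) : (blocks n c P).length = n * c := by
  simp [blocks]

theorem bit_blocks_append {n c k q : ℕ} (hk : k < n) (hq : q < c) (P : ℕ → ℕ → Prop)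
    (A : List Bool) : (blocks n c P ++ A)[k * c + q]? = some true ↔ P k q := by
  have hlt : k * c + q < n * c := by
    have := Nat.mul_le_mul_right c (Nat.succ_le_of_lt hk)
    rw [Nat.succ_mul] at this
    omega
  rw [List.getElem?_append_left (by simpa using hlt), bit_blocks hk hq]

theorem agrees_parseV (G : RawGraph) : G.Agrees (parseV G.encV) where
  m := by simp [parseV, encV]
  n := by simp [parseV, encV]
  adj v hv w hw := by simp [parseV, encV, bit_blocks_append hv hw]

theorem agrees_parseE (G : RawGraph) : G.Agrees (parseE G.encE) where
  m := by simp [parseE, encE]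
  n := by simp [parseE, encE]
  adj v hv w hw := by simp [parseE, encE, bit_blocks_append hv hw]

theorem top_parseV {G : RawGraph} (h : G.top < G.n) : (parseV G.encV).top = G.top := by
  refine leastBelow_eq (by simpa [encV] using h) fun x hx => ?_
  simp only [encV, secondSize_withSizes] at hx
  simp only [encV, firstSize_withSizes, secondSize_withSizes, restBit_withSizes, length_blocks,
    getElem?_append_add, bit_ofBits, hx, true_and]

theorem bot_parseE {G : RawGraph} (h : G.bot < G.m) : (parseE G.encE).bot = G.bot := by
  refine leastBelow_eq (by simpa [encE] using h) fun x hx => ?_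
  simp only [encE, firstSize_withSizes] at hx
  simp only [encE, firstSize_withSizes, secondSize_withSizes, restBit_withSizes, length_blocks,
    getElem?_append_add, bit_append, length_ofBits, bit_ofBits, hx, hx.not_ge, true_and,
    false_and, or_false]

theorem top_parseE {G : RawGraph} (h : G.top < G.n) : (parseE G.encE).top = G.top := by
  refine leastBelow_eq (by simpa [encE] using h) fun x hx => ?_
  simp only [encE, secondSize_withSizes] at hx
  simp only [encE, firstSize_withSizes, secondSize_withSizes, restBit_withSizes, length_blocks,
    getElem?_append_add, length_ofBits, bit_ofBits, hx, true_and]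

/-- The instance of the vertex problem given by data. -/
noncomputable def toVLfmm (G : RawGraph) (h : G.top < G.n) : VLfmmInstance where
  G := G.toBipGraph
  top := ⟨G.top, h⟩

open Classical in
/-- The instance of the edge problem given by data. -/
noncomputable def toLfmm (G : RawGraph) (h : G.bot < G.m ∧ G.top < G.n ∧ G.adj G.bot G.top) :
    LfmmInstance where
  G := G.toBipGraph
  bot := ⟨G.bot, h.1⟩
  top := ⟨G.top, h.2.1⟩
  isEdge := decide_eq_true h.2.2

theorem exists_toVLfmm (I : VLfmmInstance) :
    ∃ (G : RawGraph) (h : G.top < G.n), G.toVLfmm h = I := by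
  obtain ⟨H, top⟩ := I
  obtain ⟨G, -, htop, rfl⟩ := exists_toBipGraph H 0 top
  refine ⟨G, htop ▸ top.2, ?_⟩
  simp [toVLfmm, htop]

theorem exists_toLfmm (I : LfmmInstance) :
    ∃ (G : RawGraph) (h : G.bot < G.m ∧ G.top < G.n ∧ G.adj G.bot G.top), G.toLfmm h = I := by
  classical
  obtain ⟨H, bot, top, hedge⟩ := I
  obtain ⟨G, hbot, htop, rfl⟩ := exists_toBipGraph H bot top
  refine ⟨G, ⟨hbot ▸ bot.2, htop ▸ top.2, ?_⟩, ?_⟩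
  · rw [hbot, htop]
    exact of_decide_eq_true hedge
  · simp [toLfmm, hbot, htop]

theorem encode_toVLfmm (G : RawGraph) (h : G.top < G.n) : (G.toVLfmm h).encode = G.encV := by
  simp only [VLfmmInstance.encode, toVLfmm, encode_toBipGraph, encIndex_eq_ofBits, encV,
    withSizes, List.append_assoc]
  rfl

theorem encode_toLfmm (G : RawGraph) (h : G.bot < G.m ∧ G.top < G.n ∧ G.adj G.bot G.top) :
    (G.toLfmm h).encode = G.encE := by
  simp only [LfmmInstance.encode, toLfmm, encode_toBipGraph, encIndex_eq_ofBits, encE,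
    withSizes, List.append_assoc]
  rfl

theorem yes_toVLfmm (G : RawGraph) (h : G.top < G.n) :
    (G.toVLfmm h).Yes ↔ G.Matched G.m G.top := by
  rw [matched_iff]
  constructor
  · rintro ⟨v, hv⟩
    exact ⟨v, v.2, (G.mem_lfm_iff v ⟨G.top, h⟩).1 hv⟩
  · rintro ⟨v, hv, hc⟩
    exact ⟨⟨v, hv⟩, (G.mem_lfm_iff ⟨v, hv⟩ ⟨G.top, h⟩).2 hc⟩

theorem yes_toLfmm (G : RawGraph) (h : G.bot < G.m ∧ G.top < G.n ∧ G.adj G.bot G.top) :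
    (G.toLfmm h).Yes ↔ G.Chosen G.bot G.top :=
  G.mem_lfm_iff ⟨G.bot, h.1⟩ ⟨G.top, h.2.1⟩

/-- The vertex problem, presented by data. It comprises the unrestricted problem and the one with
degrees at most three, for false and true `b`. -/
noncomputable def presentationV (b : Prop) :
    Presentation {X | ∃ I : VLfmmInstance, I.encode = X ∧ (b → I.G.DegLeThree) ∧ I.Yes}
      RawGraph Definable where
  Ok := OkV b
  Val G := G.Matched G.m G.top
  enc := encV
  parse := parseV
  enc_ne_nil _ := withSizes_ne_nil _ _ _
  mem_iff X := by
    constructor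
    · rintro ⟨I, rfl, hd, h⟩
      obtain ⟨G, hG, rfl⟩ := exists_toVLfmm I
      exact ⟨G, ⟨hG, fun hb => G.degLeThree_toBipGraph.1 (hd hb)⟩, (G.encode_toVLfmm hG).symm,
        (G.yes_toVLfmm hG).1 h⟩
    · rintro ⟨G, ⟨hG, hd⟩, rfl, h⟩
      exact ⟨G.toVLfmm hG, G.encode_toVLfmm hG, fun hb => G.degLeThree_toBipGraph.2 (hd hb),
        (G.yes_toVLfmm hG).2 h⟩
  parse_enc G hG := by
    have h := G.agrees_parseV
    have htop := top_parseV hG.1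
    refine ⟨⟨by rw [htop, h.n]; exact hG.1, fun hb => h.degLe (hG.2 hb)⟩, ?_, ?_⟩
    · unfold encV at h htop ⊢
      rw [htop, h.m, h.n, blocks_congr h.adj]
    · rw [htop, h.m]
      exact h.matched _ le_rfl _ hG.1
  definable_parse := inferInstance
  ok_ac0 G _ := by
    unfold OkV
    infer_instance
  enc_fac0 G _ := by
    have h₁ : FAC0 fun X => blocks (G X).m (G X).n (G X).adj := FAC0.blocks _ _ _ inferInstance
    have h₂ := FAC0.ofBits (fun X => (G X).n) fun X i => i = (G X).top
    exact FAC0.withSizes _ _ _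

/-- The edge problem, presented by data; `b` as in `presentationV`. -/
noncomputable def presentationE (b : Prop) :
    Presentation {X | ∃ I : LfmmInstance, I.encode = X ∧ (b → I.G.DegLeThree) ∧ I.Yes}
      RawGraph Definable where
  Ok := OkE b
  Val G := G.Chosen G.bot G.top
  enc := encE
  parse := parseE
  enc_ne_nil _ := withSizes_ne_nil _ _ _
  mem_iff X := by
    constructor
    · rintro ⟨I, rfl, hd, h⟩
      obtain ⟨G, hG, rfl⟩ := exists_toLfmm I
      exact ⟨G, ⟨hG, fun hb => G.degLeThree_toBipGraph.1 (hd hb)⟩, (G.encode_toLfmm hG).symm,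
        (G.yes_toLfmm hG).1 h⟩
    · rintro ⟨G, ⟨hG, hd⟩, rfl, h⟩
      exact ⟨G.toLfmm hG, G.encode_toLfmm hG, fun hb => G.degLeThree_toBipGraph.2 (hd hb),
        (G.yes_toLfmm hG).2 h⟩
  parse_enc G hG := by
    have h := G.agrees_parseE
    obtain ⟨⟨hb, ht, hadj⟩, hd⟩ := hG
    have hbot := bot_parseE hb
    have htop := top_parseE ht
    refine ⟨⟨⟨?_, ?_, ?_⟩, fun hb => h.degLe (hd hb)⟩, ?_, ?_⟩
    · rwa [hbot, h.m]
    · rwa [htop, h.n]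
    · rw [hbot, htop]
      exact (h.adj _ hb _ ht).2 hadj
    · unfold encE at h hbot htop ⊢
      rw [hbot, htop, h.m, h.n, blocks_congr h.adj]
    · rw [hbot, htop]
      exact h.chosen hb ht
  definable_parse := inferInstance
  ok_ac0 G _ := by
    unfold OkE
    infer_instance
  enc_fac0 G _ := by
    have h₁ : FAC0 fun X => blocks (G X).m (G X).n (G X).adj := FAC0.blocks _ _ _ inferInstance
    have h₂ := FAC0.ofBits (fun X => (G X).m) fun X i => i = (G X).bot
    have h₃ := FAC0.ofBits (fun X => (G X).n) fun X i => i = (G X).top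
    exact FAC0.withSizes _ _ _

end RawGraph

/-! ### Elimination of negation gates -/

namespace RawCircuit

/-- Without negation gates, a state is updated by a comparator. -/
theorem state_succ_of_not_kind {C : RawCircuit} {k : ℕ} (h : ¬ C.kind k) (z : ℕ) :
    C.state (k + 1) z ↔
      z = C.snd k ∧ (C.state k (C.fst k) ∨ C.state k (C.snd k)) ∨
      z ≠ C.snd k ∧ z = C.fst k ∧ C.state k (C.fst k) ∧ C.state k (C.snd k) ∨
      z ≠ C.snd k ∧ z ≠ C.fst k ∧ C.state k z := by
  simp only [state, h, if_false]
  split_ifs <;> simp_all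

theorem state_succ_of_kind {C : RawCircuit} {k : ℕ} (h : C.kind k) (z : ℕ) :
    C.state (k + 1) z ↔ z = C.fst k ∧ ¬ C.state k z ∨ z ≠ C.fst k ∧ C.state k z := by
  simp only [state, h, if_true]
  split_ifs <;> simp_all

open Classical in
/-- The double-rail form of a circuit. Wire `m + i` carries the negation of wire `i`, and wire
`2 * m` carries `0`. A comparator is accompanied by the dual one on the negated wires; a negation
gate becomes the exchange of the wires `i` and `m + i`, for which wire `2 * m` is the temporary
store. Each gate is replaced by three gates. -/
noncomputable def doubleRail (C : RawCircuit) : RawCircuit where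
  m := 2 * C.m + 1
  n := 3 * C.n
  out := C.out
  input i := i < C.m ∧ C.input i ∨ C.m ≤ i ∧ i < 2 * C.m ∧ ¬ C.input (i - C.m)
  kind _ := False
  fst k :=
    if k % 3 = 0 then C.fst (k / 3)
    else if k % 3 = 1 then C.m + (if C.kind (k / 3) then C.fst (k / 3) else C.snd (k / 3))
    else 2 * C.m
  snd k :=
    if k % 3 = 0 then (if C.kind (k / 3) then 2 * C.m else C.snd (k / 3))
    else if k % 3 = 1 then
      (if C.kind (k / 3) then C.fst (k / 3) else C.m + C.fst (k / 3))
    else (if C.kind (k / 3) then C.m + C.fst (k / 3) else 2 * C.m)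

/-- The invariant of the double-rail simulation; wire `2 * m` is back at `0` after each gate. -/
theorem doubleRail_state {C : RawCircuit} (hC : C.Ok) :
    ∀ k ≤ C.n, (∀ z < C.m, (C.doubleRail.state (3 * k) z ↔ C.state k z) ∧
      (C.doubleRail.state (3 * k) (C.m + z) ↔ ¬ C.state k z)) ∧
      ¬ C.doubleRail.state (3 * k) (2 * C.m)
  | 0, _ => by
    simp only [state, doubleRail]
    refine ⟨fun z hz => ⟨?_, ?_⟩, ?_⟩
    · simp [hz, hz.not_ge]
    · simp [show C.m + z < 2 * C.m by omega]
    · simp [show ¬ 2 * C.m < C.m by omega]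
  | k + 1, hk => by
    obtain ⟨ih, iht⟩ := doubleRail_state hC k (by omega)
    have hkind (l : ℕ) : ¬ C.doubleRail.kind l := id
    have h₁ := (hC.2 k hk).1
    have hm₁ : (3 * k + 1) % 3 = 1 := by omega
    have hd₁ : (3 * k + 1) / 3 = k := by omega
    have hm₂ : (3 * k + 2) % 3 = 2 := by omega
    have hd₂ : (3 * k + 2) / 3 = k := by omega
    have hs₀ := fun z => state_succ_of_not_kind (hkind (3 * k)) z
    have hs₁ := fun z => state_succ_of_not_kind (hkind (3 * k + 1)) z
    have hs₂ := fun z => state_succ_of_not_kind (hkind (3 * k + 2)) z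
    rw [show 3 * (k + 1) = 3 * k + 2 + 1 by ring]
    generalize C.doubleRail.state (3 * k + 2 + 1) = S₃ at *
    rw [show 3 * k + 2 = 3 * k + 1 + 1 by ring] at hs₂
    generalize C.doubleRail.state (3 * k + 1 + 1) = S₂ at *
    generalize C.doubleRail.state (3 * k + 1) = S₁ at *
    generalize C.doubleRail.state (3 * k) = S₀ at *
    obtain ⟨ihi, ihi'⟩ := ih _ h₁
    by_cases hn : C.kind k
    · have hs := fun z => state_succ_of_kind hn z
      simp only [doubleRail, hn, hm₁, hd₁, hm₂, hd₂, if_true, Nat.mul_mod_right,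
        show 3 * k / 3 = k by omega, one_ne_zero, OfNat.ofNat_ne_zero, OfNat.ofNat_ne_one,
        if_false] at hs₀ hs₁ hs₂
      have a₁ : ¬ S₁ (C.fst k) := by rw [hs₀]; grind
      have a₂ : S₁ (2 * C.m) ↔ C.state k (C.fst k) := by rw [hs₀]; grind
      have a₃ : S₁ (C.m + C.fst k) ↔ ¬ C.state k (C.fst k) := by rw [hs₀]; grind
      have b₁ : S₂ (C.fst k) ↔ ¬ C.state k (C.fst k) := by rw [hs₁]; grind
      have b₂ : S₂ (2 * C.m) ↔ C.state k (C.fst k) := by rw [hs₁]; grind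
      have b₃ : ¬ S₂ (C.m + C.fst k) := by rw [hs₁]; grind
      have c₁ : S₃ (C.fst k) ↔ ¬ C.state k (C.fst k) := by rw [hs₂]; grind
      have c₂ : ¬ S₃ (2 * C.m) := by rw [hs₂]; grind
      have c₃ : S₃ (C.m + C.fst k) ↔ C.state k (C.fst k) := by rw [hs₂]; grind
      have hother : ∀ z, z ≠ C.fst k → z ≠ C.m + C.fst k → z ≠ 2 * C.m → (S₃ z ↔ S₀ z) := by
        intro z h h' h''
        rw [hs₂, hs₁ z, hs₀ z]
        simp [h, h', h'']
      refine ⟨fun z hz => ?_, c₂⟩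
      obtain ⟨ihz, ihz'⟩ := ih z hz
      rw [hs]
      by_cases hzi : z = C.fst k
      · subst hzi
        simp [c₁, c₃]
      · rw [hother z (by omega) (by omega) (by omega),
          hother (C.m + z) (by omega) (by omega) (by omega), ihz, ihz']
        simp [hzi]
    · have hs := fun z => state_succ_of_not_kind hn z
      have h₂ := (hC.2 k hk).2 hn
      obtain ⟨ihj, ihj'⟩ := ih _ h₂
      simp only [doubleRail, hn, hm₁, hd₁, hm₂, hd₂, if_true, Nat.mul_mod_right,
        show 3 * k / 3 = k by omega, one_ne_zero, OfNat.ofNat_ne_zero, OfNat.ofNat_ne_one,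
        if_false] at hs₀ hs₁ hs₂
      have c : ∀ z, S₃ z ↔ S₂ z := by
        intro z
        rw [hs₂]
        by_cases hz : z = 2 * C.m <;> simp [hz]
      have a : ∀ z < C.m, (S₁ (C.m + z) ↔ ¬ C.state k z) := by
        intro z hz
        rw [hs₀, (ih z hz).2]
        simp [show C.m + z ≠ C.fst k by omega, show C.m + z ≠ C.snd k by omega]
      refine ⟨fun z hz => ⟨?_, ?_⟩, ?_⟩
      · rw [hs, c, hs₁, hs₀ z]
        simp [show z ≠ C.m + C.fst k by omega, show z ≠ C.m + C.snd k by omega, ihi, ihj,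
          (ih z hz).1]
      · rw [hs, c, hs₁, a _ h₁, a _ h₂, a z hz]
        simp only [Nat.add_left_cancel_iff, ne_eq]
        by_cases hzi : z = C.fst k
        · by_cases hzj : z = C.snd k
          · rw [← hzi, ← hzj]
            simp
          · simp [hzi, hzi ▸ hzj, or_comm, imp_iff_not_or]
        · by_cases hzj : z = C.snd k
          · simp [hzj, hzj ▸ hzi, and_comm]
          · simp [hzi, hzj]
      · rw [c, hs₁, hs₀ (2 * C.m)]
        simp [show 2 * C.m ≠ C.m + C.fst k by omega, show 2 * C.m ≠ C.m + C.snd k by omega,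
          show 2 * C.m ≠ C.fst k by omega, show 2 * C.m ≠ C.snd k by omega, iht]

theorem doubleRail_okPos {C : RawCircuit} (hC : C.Ok) : C.doubleRail.OkPos := by
  refine ⟨⟨?_, fun k hk => ?_⟩, fun _ _ => id⟩
  · have := hC.1
    simp only [doubleRail]
    omega
  · have hk' : k < 3 * C.n := hk
    have h := hC.2 (k / 3) (by omega)
    simp only [doubleRail]
    by_cases hn : C.kind (k / 3)
    · simp only [hn, if_true]
      split_ifs <;> omega
    · have := h.2 hn
      simp only [hn, if_false]
      split_ifs <;> omega

theorem doubleRail_val {C : RawCircuit} (hC : C.Ok) : C.doubleRail.Val ↔ C.Val :=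
  ((doubleRail_state hC C.n le_rfl).1 C.out hC.1).1

theorem Definable.doubleRail (C : List Bool → RawCircuit) [Definable C] :
    Definable fun X => (C X).doubleRail := by
  constructor <;> intros <;> simp only [RawCircuit.doubleRail] <;> infer_instance

end RawCircuit

theorem ccvNeg_reducible_ccv : AC0Reducible CcvNeg Ccv :=
  RawCircuit.ccvNegPresentation.reducible RawCircuit.ccvPresentation RawCircuit.doubleRail
    (fun C _ => RawCircuit.Definable.doubleRail C)
    fun _ hC => ⟨RawCircuit.doubleRail_okPos hC, RawCircuit.doubleRail_val hC⟩

/-! ### Circuits for matchings -/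

namespace RawGraph

/-- A circuit whose first `K` gates simulate the construction of the matching of `G`. Wire `v < m`
belongs to the bottom node `v` and carries `1` as long as this node is unmatched; wire `m + w`
belongs to the top node `w` and carries `1` as soon as this node is matched. Gate `v * n + w`
is the comparator `(v, m + w)` if `v` and `w` are adjacent, and otherwise does nothing. -/
structure Simulates (C : RawCircuit) (G : RawGraph) (K : ℕ) : Prop where
  input : ∀ i, C.input i ↔ i < G.m
  kind : ∀ k < K, ¬ C.kind k
  fst : ∀ k < K, C.fst k = k / G.n
  snd_of_adj : ∀ k < K, G.adj (k / G.n) (k % G.n) → C.snd k = G.m + k % G.n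
  snd_of_not_adj : ∀ k < K, ¬ G.adj (k / G.n) (k % G.n) → C.snd k = k / G.n

/-- What the wires carry when the gates of the pairs before `(v, w)` have been evaluated. -/
structure WiresAt (G : RawGraph) (S : ℕ → Prop) (v w : ℕ) : Prop where
  later : ∀ u, v < u → u < G.m → S u
  current : v < G.m → (S v ↔ ∀ w' < w, G.adj v w' → G.Matched v w')
  top : ∀ x < G.n, (S (G.m + x) ↔ G.Matched v x ∨ x < w ∧ G.Chosen v x)

theorem WiresAt.next_row {G : RawGraph} {S : ℕ → Prop} {v : ℕ} (h : WiresAt G S v G.n) :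
    WiresAt G S (v + 1) 0 where
  later u hu := h.later u (by omega)
  current hv := by simp [h.later (v + 1) (Nat.lt_succ_self v) hv]
  top x hx := by simp [h.top x hx, hx, matched_succ]

/-- One gate of the simulation. If `v` and `w` are adjacent, the comparator moves a `1` from wire `v`
to wire `m + w` exactly if the former carries `1` and the latter `0`, that is, if `v` and `w`
are both unmatched. -/
theorem Simulates.wiresAt_succ {C : RawCircuit} {G : RawGraph} {K : ℕ} (h : Simulates C G K)
    {v w : ℕ} (hv : v < G.m) (hw : w < G.n) (hK : v * G.n + w < K)
    (ih : WiresAt G (C.state (v * G.n + w)) v w) :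
    WiresAt G (C.state (v * G.n + w + 1)) v (w + 1) := by
  have hdiv : (v * G.n + w) / G.n = v := by
    rw [mul_comm, Nat.mul_add_div (by omega), Nat.div_eq_of_lt hw, add_zero]
  have hmod : (v * G.n + w) % G.n = w := by
    rw [mul_comm, Nat.mul_add_mod, Nat.mod_eq_of_lt hw]
  have hs := fun z => RawCircuit.state_succ_of_not_kind (h.kind _ hK) z
  have hsnd := h.snd_of_adj _ hK
  have hsnd' := h.snd_of_not_adj _ hK
  rw [h.fst _ hK, hdiv] at hs
  rw [hdiv, hmod] at hsnd hsnd'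
  have hcur := ih.current hv
  have htop := ih.top w hw
  simp only [lt_irrefl, false_and, or_false] at htop
  by_cases hadj : G.adj v w
  · rw [hsnd hadj] at hs
    refine ⟨fun u hu hum => ?_, fun _ => ?_, fun x hx => ?_⟩
    · rw [hs]
      simp [show u ≠ G.m + w by omega, hu.ne', ih.later u hu hum]
    · rw [hs, hcur, htop]
      simp only [show v ≠ G.m + w by omega, ne_eq, not_false_eq_true, not_true_eq_false, true_and,
        false_and, false_or, or_false]
      constructor
      · rintro ⟨h₁, h₂⟩ w' hw' ha
        rcases Nat.lt_succ_iff_lt_or_eq.1 hw' with hw' | rfl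
        · exact h₁ w' hw' ha
        · exact h₂
      · exact fun h => ⟨fun w' hw' => h w' (by omega), h w (Nat.lt_succ_self w) hadj⟩
    · rw [hs, hcur, htop]
      by_cases hxw : x = w
      · subst hxw
        have hc : G.Chosen v x ↔ ¬ G.Matched v x ∧ ∀ w' < x, G.adj v w' → G.Matched v w' := by
          simp [Chosen, hw, hadj]
        simp only [true_and, ne_eq, not_true_eq_false, false_and, or_false,
          Nat.lt_succ_self, hc]
        tauto
      · have hxw' : x < w + 1 ↔ x < w := by omega
        simp [hxw, show G.m + x ≠ v by omega, hxw', ih.top x hx]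
  · rw [hsnd' hadj] at hs
    have hs' : ∀ z, C.state (v * G.n + w + 1) z ↔ C.state (v * G.n + w) z := by
      intro z
      rw [hs]
      by_cases hz : z = v <;> simp [hz]
    refine ⟨fun u hu hum => (hs' u).2 (ih.later u hu hum), fun _ => ?_, fun x hx => ?_⟩
    · rw [hs', hcur]
      refine ⟨fun h w' hw' ha => ?_, fun h w' hw' => h w' (by omega)⟩
      rcases Nat.lt_succ_iff_lt_or_eq.1 hw' with hw' | rfl
      · exact h w' hw' ha
      · exact absurd ha hadj
    · rw [hs', ih.top x hx]
      refine or_congr_right (and_congr_left fun hc => ?_)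
      have : x ≠ w := by
        rintro rfl
        exact hadj hc.2.1
      omega

theorem Simulates.wiresAt {C : RawCircuit} {G : RawGraph} {K : ℕ} (h : Simulates C G K)
    (hK : K ≤ G.m * G.n) :
    ∀ v w, w ≤ G.n → v * G.n + w ≤ K → WiresAt G (C.state (v * G.n + w)) v w := by
  have row : ∀ v, (v * G.n ≤ K → WiresAt G (C.state (v * G.n)) v 0) →
      ∀ w, w ≤ G.n → v * G.n + w ≤ K → WiresAt G (C.state (v * G.n + w)) v w := by
    intro v h₀ w
    induction w with
    | zero => exact fun _ hK => h₀ hK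
    | succ w ih =>
      intro hw hvw
      have hv : v < G.m := by
        by_contra hv
        have := Nat.mul_le_mul_right G.n (not_lt.1 hv)
        omega
      exact h.wiresAt_succ hv hw hvw (ih (by omega) (by omega))
  intro v
  induction v with
  | zero =>
    refine row 0 fun _ => ?_
    rw [zero_mul]
    constructor
    · exact fun u _ hu => (h.input u).2 hu
    · exact fun hv => by simp [RawCircuit.state, h.input, hv]
    · exact fun x _ => by simp [RawCircuit.state, h.input, Matched]
  | succ v ih =>
    refine row (v + 1) fun hv => ?_
    rw [Nat.succ_mul] at hv ⊢
    exact (ih G.n le_rfl hv).next_row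

open Classical in
/-- The circuit that simulates the construction of the matching; its output wire belongs to the
designated top node. -/
noncomputable def matchingCircuit (G : RawGraph) : RawCircuit where
  m := G.m + G.n
  n := G.m * G.n
  out := G.m + G.top
  input i := i < G.m
  kind _ := False
  fst k := k / G.n
  snd k := if G.adj (k / G.n) (k % G.n) then G.m + k % G.n else k / G.n

theorem matchingCircuit_simulates (G : RawGraph) :
    Simulates G.matchingCircuit G (G.m * G.n) where
  input _ := Iff.rfl
  kind _ _ := id
  fst _ _ := rfl
  snd_of_adj _ _ h := if_pos h
  snd_of_not_adj _ _ h := if_neg h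

theorem div_lt_of_lt_mul {k m n : ℕ} (h : k < m * n) : k / n < m ∧ k % n < n := by
  have hn : 0 < n := Nat.pos_of_ne_zero (by rintro rfl; simp at h)
  exact ⟨(Nat.div_lt_iff_lt_mul hn).2 h, Nat.mod_lt _ hn⟩

theorem matchingCircuit_ok {G : RawGraph} (h : G.top < G.n) : G.matchingCircuit.Ok := by
  refine ⟨Nat.add_lt_add_left h _, fun k hk => ?_⟩
  obtain ⟨h₁, h₂⟩ := div_lt_of_lt_mul hk
  simp only [matchingCircuit]
  refine ⟨by omega, fun _ => ?_⟩
  split_ifs <;> omega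

theorem matchingCircuit_val {G : RawGraph} (h : G.top < G.n) :
    G.matchingCircuit.Val ↔ G.Matched G.m G.top := by
  change G.matchingCircuit.state (G.m * G.n) (G.m + G.top) ↔ _
  have := (G.matchingCircuit_simulates.wiresAt le_rfl G.m 0 (Nat.zero_le _) le_rfl).top _ h
  simpa using this

theorem Definable.matchingCircuit (G : List Bool → RawGraph) [Definable G] :
    RawCircuit.Definable fun X => (G X).matchingCircuit := by
  constructor <;> intros <;> simp only [RawGraph.matchingCircuit] <;> infer_instance

open Classical in
/-- The simulation of the construction of the matching is stopped before the gate of the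
designated edge. The designated edge is chosen iff its bottom node is then still unmatched and its
top node, too; the last two gates compute this on the wire of the top node. -/
noncomputable def edgeCircuit (G : RawGraph) : RawCircuit where
  m := G.m + G.n
  n := G.bot * G.n + G.top + 2
  out := G.m + G.top
  input i := i < G.m
  kind k := k = G.bot * G.n + G.top
  fst k := if k < G.bot * G.n + G.top then k / G.n else G.m + G.top
  snd k :=
    if k < G.bot * G.n + G.top then
      if G.adj (k / G.n) (k % G.n) then G.m + k % G.n else k / G.n
    else G.bot

theorem edgeCircuit_simulates (G : RawGraph) :
    Simulates G.edgeCircuit G (G.bot * G.n + G.top) where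
  input _ := Iff.rfl
  kind _ h := h.ne
  fst _ h := if_pos h
  snd_of_adj k h h' := by simp [edgeCircuit, h, h']
  snd_of_not_adj k h h' := by simp [edgeCircuit, h, h']

theorem edge_index_lt {G : RawGraph} (hb : G.bot < G.m) (ht : G.top < G.n) :
    G.bot * G.n + G.top < G.m * G.n := by
  have := Nat.mul_le_mul_right G.n (Nat.succ_le_of_lt hb)
  rw [Nat.succ_mul] at this
  omega

theorem edgeCircuit_ok {G : RawGraph} (hb : G.bot < G.m) (ht : G.top < G.n) :
    G.edgeCircuit.Ok := by
  refine ⟨Nat.add_lt_add_left ht _, fun k _ => ?_⟩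
  simp only [edgeCircuit]
  by_cases hk : k < G.bot * G.n + G.top
  · obtain ⟨h₁, h₂⟩ := div_lt_of_lt_mul (hk.trans (edge_index_lt hb ht))
    simp only [hk, if_true]
    refine ⟨by omega, fun _ => ?_⟩
    split_ifs <;> omega
  · simp only [hk, if_false]
    omega

theorem edgeCircuit_val {G : RawGraph} (hb : G.bot < G.m) (ht : G.top < G.n)
    (hadj : G.adj G.bot G.top) : G.edgeCircuit.Val ↔ G.Chosen G.bot G.top := by
  have h := G.edgeCircuit_simulates.wiresAt (edge_index_lt hb ht).le G.bot G.top ht.le le_rfl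
  have hcur := h.current hb
  have htop := h.top _ ht
  simp only [lt_irrefl, false_and, or_false] at htop
  change G.edgeCircuit.state (G.bot * G.n + G.top + 1 + 1) (G.m + G.top) ↔ _
  have hkind : G.edgeCircuit.kind (G.bot * G.n + G.top) := rfl
  have hkind' : ¬ G.edgeCircuit.kind (G.bot * G.n + G.top + 1) := Nat.succ_ne_self _
  have hf : G.edgeCircuit.fst (G.bot * G.n + G.top) = G.m + G.top := by simp [edgeCircuit]
  have hf' : G.edgeCircuit.fst (G.bot * G.n + G.top + 1) = G.m + G.top := by simp [edgeCircuit]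
  have hs' : G.edgeCircuit.snd (G.bot * G.n + G.top + 1) = G.bot := by simp [edgeCircuit]
  rw [RawCircuit.state_succ_of_not_kind hkind', hf', hs', RawCircuit.state_succ_of_kind hkind,
    RawCircuit.state_succ_of_kind hkind, hf, hcur, htop]
  have hne : G.bot ≠ G.m + G.top := by omega
  simp [hne, hne.symm, Chosen, ht, hadj]

theorem Definable.edgeCircuit (G : List Bool → RawGraph) [Definable G] :
    RawCircuit.Definable fun X => (G X).edgeCircuit := by
  constructor <;> intros <;> simp only [RawGraph.edgeCircuit] <;> infer_instance

end RawGraph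

theorem vLfmm_eq :
    VLfmm = {X | ∃ I : VLfmmInstance, I.encode = X ∧ (False → I.G.DegLeThree) ∧ I.Yes} := by
  simp only [false_imp_iff, true_and]
  rfl

theorem lfmm_eq :
    Lfmm = {X | ∃ I : LfmmInstance, I.encode = X ∧ (False → I.G.DegLeThree) ∧ I.Yes} := by
  simp only [false_imp_iff, true_and]
  rfl

theorem vLfmm3_eq :
    VLfmm3 = {X | ∃ I : VLfmmInstance, I.encode = X ∧ (True → I.G.DegLeThree) ∧ I.Yes} := by
  simp only [true_imp_iff]
  rfl

theorem lfmm3_eq :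
    Lfmm3 = {X | ∃ I : LfmmInstance, I.encode = X ∧ (True → I.G.DegLeThree) ∧ I.Yes} := by
  simp only [true_imp_iff]
  rfl

theorem vLfmm_reducible_ccvNeg : AC0Reducible VLfmm CcvNeg := by
  rw [vLfmm_eq]
  exact (RawGraph.presentationV False).reducible RawCircuit.ccvNegPresentation
    RawGraph.matchingCircuit (fun G _ => RawGraph.Definable.matchingCircuit G)
    fun _ hG => ⟨RawGraph.matchingCircuit_ok hG.1, RawGraph.matchingCircuit_val hG.1⟩

theorem lfmm_reducible_ccvNeg : AC0Reducible Lfmm CcvNeg := by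
  rw [lfmm_eq]
  exact (RawGraph.presentationE False).reducible RawCircuit.ccvNegPresentation
    RawGraph.edgeCircuit (fun G _ => RawGraph.Definable.edgeCircuit G)
    fun _ ⟨⟨hb, ht, hadj⟩, _⟩ =>
      ⟨RawGraph.edgeCircuit_ok hb ht, RawGraph.edgeCircuit_val hb ht hadj⟩

theorem vLfmm3_reducible_vLfmm : AC0Reducible VLfmm3 VLfmm := by
  rw [vLfmm_eq, vLfmm3_eq]
  exact (RawGraph.presentationV True).reducible (RawGraph.presentationV False) id
    (fun _ h => h) fun _ hG => ⟨⟨hG.1, False.elim⟩, Iff.rfl⟩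

theorem lfmm3_reducible_lfmm : AC0Reducible Lfmm3 Lfmm := by
  rw [lfmm_eq, lfmm3_eq]
  exact (RawGraph.presentationE True).reducible (RawGraph.presentationE False) id
    (fun _ h => h) fun _ hG => ⟨⟨hG.1, False.elim⟩, Iff.rfl⟩

/-! ### Matchings that evaluate circuits -/

namespace RawGraph

theorem matched_succ_of_least {G : RawGraph} {v w₀ : ℕ} (hw₀ : w₀ < G.n) (hadj : G.adj v w₀)
    (hfree : ¬ G.Matched v w₀) (hleast : ∀ w, w < w₀ → G.adj v w → G.Matched v w) (w : ℕ) :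
    G.Matched (v + 1) w ↔ G.Matched v w ∨ w = w₀ := by
  have hc : G.Chosen v w₀ := ⟨hw₀, hadj, hfree, hleast⟩
  rw [matched_succ]
  refine or_congr_right ⟨fun h => h.unique hc, ?_⟩
  rintro rfl
  exact hc

theorem matched_succ_of_isolated {G : RawGraph} {v : ℕ} (h : ∀ w, ¬ G.adj v w) (w : ℕ) :
    G.Matched (v + 1) w ↔ G.Matched v w := by
  rw [matched_succ]
  exact or_iff_left fun hc => h w hc.2.1

end RawGraph

namespace RawCircuit

/-- Wire `z` is one of the two wires of gate `l`. -/
def OnGate (C : RawCircuit) (l z : ℕ) : Prop :=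
  z = C.fst l ∨ z = C.snd l

open Classical in
/-- The number of the top node `(l, z)`, which stands for wire `z` after `l` gates. Each layer has
`m + 1` places, of which the first is for the disjunction output of the preceding gate, so that this
output precedes the conjunction output. -/
noncomputable def place (C : RawCircuit) (l z : ℕ) : ℕ :=
  l * (C.m + 1) + if l ≠ 0 ∧ z = C.snd (l - 1) then 0 else z + 1

/-- The graph that evaluates a comparator circuit: the top node `(l, z)` is matched by the bottom
nodes that precede those of layer `l` if and only if wire `z` carries `1` after `l` gates. The
bottom nodes are

* a node `z` for each wire `z`, adjacent to the top node `(0, z)` if the input bit is `1`;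
* a node `(l, z)`, with number `(l + 1) * m + z`, for each gate `l` and each wire `z`. It is adjacent
  to the top node `(l, z)`, and to `(l + 1, z)`; if `z` is on gate `l`, it is adjacent to both
  output nodes of this gate. It takes the top node `(l, z)` if this is free, and otherwise
  it passes the `1` on to layer `l + 1`;
* a last node, adjacent to the top node of the output and to a further top node, which is
  matched if and only if the output is `1`. -/
noncomputable def layeredGraph (C : RawCircuit) : RawGraph where
  m := (C.n + 1) * C.m + 1
  n := (C.n + 1) * (C.m + 1) + 1
  bot := (C.n + 1) * C.m
  top := (C.n + 1) * (C.m + 1)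
  adj v w :=
    (∃ z, z < C.m ∧ v = z ∧ w = C.place 0 z ∧ C.input z) ∨
    (∃ l, l < C.n ∧ ∃ z, z < C.m ∧ v = (l + 1) * C.m + z ∧
      (w = C.place l z ∨ ∃ z', z' < C.m ∧ w = C.place (l + 1) z' ∧
        (z = z' ∨ C.OnGate l z ∧ C.OnGate l z'))) ∨
    v = (C.n + 1) * C.m ∧ (w = C.place C.n C.out ∨ w = (C.n + 1) * (C.m + 1))

section Definable

variable {C : List Bool → RawCircuit} [Definable C] {k : ℕ} {f g : List Bool → (Fin k → ℕ) → ℕ}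
  [AC0Fun f] [AC0Fun g]

instance : AC0Rel fun X v => (C X).OnGate (f X v) (g X v) := by
  unfold OnGate
  infer_instance

instance : AC0Fun fun X v => (C X).place (f X v) (g X v) := by
  unfold place
  infer_instance

end Definable

theorem Definable.layeredGraph (C : List Bool → RawCircuit) [Definable C] :
    RawGraph.Definable fun X => (C X).layeredGraph := by
  constructor <;> intros <;> simp only [RawCircuit.layeredGraph] <;> infer_instance

theorem le_place (C : RawCircuit) (l z : ℕ) : l * (C.m + 1) ≤ C.place l z :=
  Nat.le_add_right _ _

theorem place_lt {C : RawCircuit} {z : ℕ} (l : ℕ) (hz : z < C.m) :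
    C.place l z < (l + 1) * (C.m + 1) := by
  rw [place, Nat.succ_mul]
  split_ifs <;> omega

theorem place_lt_place {C : RawCircuit} {l l' z : ℕ} (z' : ℕ) (hl : l < l') (hz : z < C.m) :
    C.place l z < C.place l' z' :=
  (place_lt l hz).trans_le
    ((Nat.mul_le_mul_right _ (Nat.succ_le_of_lt hl)).trans (C.le_place l' z'))

theorem place_inj {C : RawCircuit} {l l' z z' : ℕ} (hz : z < C.m) (hz' : z' < C.m) :
    C.place l z = C.place l' z' ↔ l = l' ∧ z = z' := by
  constructor
  · intro h
    rcases lt_trichotomy l l' with hl | rfl | hl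
    · exact absurd h (place_lt_place z' hl hz).ne
    · refine ⟨rfl, ?_⟩
      unfold place at h
      split_ifs at h <;> omega
    · exact absurd h (place_lt_place z hl hz').ne'
  · rintro ⟨rfl, rfl⟩
    rfl

theorem place_snd (C : RawCircuit) (l : ℕ) : C.place (l + 1) (C.snd l) = (l + 1) * (C.m + 1) := by
  simp [place]

theorem row_lt {m l n z : ℕ} (hl : l < n) (hz : z < m) : l * m + z < n * m := by
  have := Nat.mul_le_mul_right m (Nat.succ_le_of_lt hl)
  rw [Nat.succ_mul] at this
  omega

theorem row_inj {m l l' z z' : ℕ} (hz : z < m) (hz' : z' < m) (h : l * m + z = l' * m + z') :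
    l = l' ∧ z = z' := by
  rcases lt_trichotomy l l' with hl | rfl | hl
  · have := row_lt hl hz
    omega
  · exact ⟨rfl, by omega⟩
  · have := row_lt hl hz'
    omega

theorem adj_input {C : RawCircuit} {z : ℕ} (hz : z < C.m) (w : ℕ) :
    C.layeredGraph.adj z w ↔ w = C.place 0 z ∧ C.input z := by
  constructor
  · rintro (⟨z', -, rfl, h⟩ | ⟨l, -, z', -, h, -⟩ | ⟨h, -⟩)
    · exact h
    · rw [Nat.succ_mul] at h
      omega
    · rw [Nat.succ_mul] at h
      omega
  · exact fun h => Or.inl ⟨z, hz, rfl, h⟩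

theorem adj_gate {C : RawCircuit} {l z : ℕ} (hl : l < C.n) (hz : z < C.m) (w : ℕ) :
    C.layeredGraph.adj ((l + 1) * C.m + z) w ↔
      w = C.place l z ∨ ∃ z', z' < C.m ∧ w = C.place (l + 1) z' ∧
        (z = z' ∨ C.OnGate l z ∧ C.OnGate l z') := by
  constructor
  · rintro (⟨z', hz', h, -⟩ | ⟨l', -, z', hz', h, h'⟩ | ⟨h, -⟩)
    · rw [Nat.succ_mul] at h
      omega
    · obtain ⟨hl', rfl⟩ := row_inj hz hz' h
      obtain rfl : l = l' := by omega
      exact h'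
    · have := row_lt (show l + 1 < C.n + 1 by omega) hz
      omega
  · exact fun h => Or.inr (Or.inl ⟨l, hl, z, hz, rfl, h⟩)

theorem adj_last {C : RawCircuit} (w : ℕ) :
    C.layeredGraph.adj ((C.n + 1) * C.m) w ↔
      w = C.place C.n C.out ∨ w = (C.n + 1) * (C.m + 1) := by
  constructor
  · rintro (⟨z, hz, h, -⟩ | ⟨l, hl, z, hz, h, -⟩ | ⟨-, h⟩)
    · rw [Nat.succ_mul] at h
      omega
    · have := row_lt (show l + 1 < C.n + 1 by omega) hz
      omega
    · exact h
  · exact fun h => Or.inr (Or.inr ⟨rfl, h⟩)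

/-- What wire `z` has received of the outputs of the comparator `(x, y)`, when the wires before `k`
have been processed and their bits are given by `B`: the first `1` on a wire of the gate goes
to wire `y`, the second one goes to wire `x`. -/
def Received (B : ℕ → Prop) (x y k z : ℕ) : Prop :=
  z = y ∧ (∃ u, u < k ∧ (u = x ∨ u = y) ∧ B u) ∨
  z ≠ y ∧ z = x ∧ x < k ∧ y < k ∧ B x ∧ B y ∨
  z ≠ y ∧ z ≠ x ∧ z < k ∧ B z

theorem not_received_zero (B : ℕ → Prop) (x y z : ℕ) : ¬ Received B x y 0 z := by
  simp [Received]

section Received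

variable {B : ℕ → Prop} {x y k : ℕ}

theorem exists_lt_succ_and {p : ℕ → Prop} : (∃ u, u < k + 1 ∧ p u) ↔ (∃ u, u < k ∧ p u) ∨ p k := by
  constructor
  · rintro ⟨u, hu, h⟩
    rcases Nat.lt_succ_iff_lt_or_eq.1 hu with hu | rfl
    · exact Or.inl ⟨u, hu, h⟩
    · exact Or.inr h
  · rintro (⟨u, hu, h⟩ | h)
    · exact ⟨u, by omega, h⟩
    · exact ⟨k, by omega, h⟩

theorem received_succ_of_not (hk : ¬ B k) (z : ℕ) :
    Received B x y (k + 1) z ↔ Received B x y k z := by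
  simp only [Received, exists_lt_succ_and, hk, and_false, or_false]
  grind

theorem received_succ_of_off (hk : B k) (hx : k ≠ x) (hy : k ≠ y) (z : ℕ) :
    Received B x y (k + 1) z ↔ Received B x y k z ∨ z = k := by
  simp only [Received, exists_lt_succ_and, hx, hy, or_false, false_and]
  grind

theorem received_succ_of_first (hk : B k) (hxy : k = x ∨ k = y) (h : ¬ Received B x y k y)
    (z : ℕ) : Received B x y (k + 1) z ↔ Received B x y k z ∨ z = y := by
  simp only [Received, exists_lt_succ_and] at h ⊢
  grind

theorem received_succ_of_second (hk : B k) (hxy : k = x ∨ k = y) (h : Received B x y k y)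
    (z : ℕ) : Received B x y (k + 1) z ↔ Received B x y k z ∨ z = x := by
  simp only [Received, exists_lt_succ_and] at h ⊢
  grind

theorem not_received_of_second (hxy : k = x ∨ k = y) (h : Received B x y k y) :
    ¬ Received B x y k x := by
  simp only [Received] at h ⊢
  grind

end Received

/-- At the end of a layer, the wires have received their values after the gate. -/
theorem received_iff_state {C : RawCircuit} (hC : C.OkPos) {l : ℕ} (hl : l < C.n) {z : ℕ}
    (hz : z < C.m) :
    Received (C.state l) (C.fst l) (C.snd l) C.m z ↔ C.state (l + 1) z := by
  have h₁ := (hC.1.2 l hl).1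
  have h₂ := (hC.1.2 l hl).2 (hC.2 l hl)
  rw [state_succ_of_not_kind (hC.2 l hl), Received]
  have : (∃ u, u < C.m ∧ (u = C.fst l ∨ u = C.snd l) ∧ C.state l u) ↔
      C.state l (C.fst l) ∨ C.state l (C.snd l) := by
    constructor
    · rintro ⟨u, -, rfl | rfl, h⟩
      · exact Or.inl h
      · exact Or.inr h
    · rintro (h | h)
      · exact ⟨_, h₁, Or.inl rfl, h⟩
      · exact ⟨_, h₂, Or.inr rfl, h⟩
  rw [this]
  simp only [h₁, h₂, hz, true_and]

/-- The set of the top nodes in the layers before `l`, of those in layer `l` with `P`, and of those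
in layer `l + 1` with `Q`. -/
def Front (C : RawCircuit) (l : ℕ) (P Q : ℕ → Prop) (w : ℕ) : Prop :=
  (∃ l' < l, ∃ z < C.m, w = C.place l' z) ∨ (∃ z < C.m, w = C.place l z ∧ P z) ∨
    ∃ z < C.m, w = C.place (l + 1) z ∧ Q z

section Front

variable {C : RawCircuit} {l : ℕ} {P Q : ℕ → Prop}

theorem front_place {z : ℕ} (hz : z < C.m) : C.Front l P Q (C.place l z) ↔ P z := by
  constructor
  · rintro (⟨l', hl', z', hz', h⟩ | ⟨z', hz', h, hP⟩ | ⟨z', hz', h, hP⟩)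
    · have := (place_inj hz hz').1 h
      omega
    · rwa [((place_inj hz hz').1 h).2]
    · have := (place_inj hz hz').1 h
      omega
  · exact fun h => Or.inr (Or.inl ⟨z, hz, rfl, h⟩)

theorem front_place_succ {z : ℕ} (hz : z < C.m) :
    C.Front l P Q (C.place (l + 1) z) ↔ Q z := by
  constructor
  · rintro (⟨l', hl', z', hz', h⟩ | ⟨z', hz', h, hP⟩ | ⟨z', hz', h, hP⟩)
    · have := (place_inj hz hz').1 h
      omega
    · have := (place_inj hz hz').1 h
      omega
    · rwa [((place_inj hz hz').1 h).2]
  · exact fun h => Or.inr (Or.inr ⟨z, hz, rfl, h⟩)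

theorem front_or_place {k : ℕ} (hk : k < C.m) (w : ℕ) :
    C.Front l P Q w ∨ w = C.place l k ↔ C.Front l (fun z => P z ∨ z = k) Q w := by
  constructor
  · rintro ((h | ⟨z, hz, h, hP⟩ | h) | h)
    · exact Or.inl h
    · exact Or.inr (Or.inl ⟨z, hz, h, Or.inl hP⟩)
    · exact Or.inr (Or.inr h)
    · exact Or.inr (Or.inl ⟨k, hk, h, Or.inr rfl⟩)
  · rintro (h | ⟨z, hz, h, hP | rfl⟩ | h)
    · exact Or.inl (Or.inl h)
    · exact Or.inl (Or.inr (Or.inl ⟨z, hz, h, hP⟩))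
    · exact Or.inr h
    · exact Or.inl (Or.inr (Or.inr h))

theorem front_or_place_succ {k : ℕ} (hk : k < C.m) (w : ℕ) :
    C.Front l P Q w ∨ w = C.place (l + 1) k ↔ C.Front l P (fun z => Q z ∨ z = k) w := by
  constructor
  · rintro ((h | h | ⟨z, hz, h, hP⟩) | h)
    · exact Or.inl h
    · exact Or.inr (Or.inl h)
    · exact Or.inr (Or.inr ⟨z, hz, h, Or.inl hP⟩)
    · exact Or.inr (Or.inr ⟨k, hk, h, Or.inr rfl⟩)
  · rintro (h | h | ⟨z, hz, h, hP | rfl⟩)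
    · exact Or.inl (Or.inl h)
    · exact Or.inl (Or.inr (Or.inl h))
    · exact Or.inl (Or.inr (Or.inr ⟨z, hz, h, hP⟩))
    · exact Or.inr h

theorem front_congr {P' Q' : ℕ → Prop} (hP : ∀ z < C.m, (P z ↔ P' z))
    (hQ : ∀ z < C.m, (Q z ↔ Q' z)) (w : ℕ) : C.Front l P Q w ↔ C.Front l P' Q' w := by
  unfold Front
  refine or_congr_right (or_congr ?_ ?_)
  · exact exists_congr fun z => and_congr_right fun hz => and_congr_right fun _ => hP z hz
  · exact exists_congr fun z => and_congr_right fun hz => and_congr_right fun _ => hQ z hz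

theorem front_next (w : ℕ) (hP : ∀ z < C.m, P z) :
    C.Front l P Q w ↔ C.Front (l + 1) Q (fun _ => False) w := by
  constructor
  · rintro (⟨l', hl', h⟩ | ⟨z, hz, h, -⟩ | h)
    · exact Or.inl ⟨l', by omega, h⟩
    · exact Or.inl ⟨l, by omega, z, hz, h⟩
    · exact Or.inr (Or.inl h)
  · rintro (⟨l', hl', z, hz, h⟩ | h | ⟨_, _, _, h⟩)
    · rcases Nat.lt_succ_iff_lt_or_eq.1 hl' with hl' | rfl
      · exact Or.inl ⟨l', hl', z, hz, h⟩
      · exact Or.inr (Or.inl ⟨z, hz, h, hP z hz⟩)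
    · exact Or.inr (Or.inr h)
    · exact h.elim

end Front

theorem place_lt_size {C : RawCircuit} {l z : ℕ} (hl : l ≤ C.n) (hz : z < C.m) :
    C.place l z < (C.n + 1) * (C.m + 1) :=
  (place_lt l hz).trans_le (Nat.mul_le_mul_right _ (by omega))

theorem matched_inputs (C : RawCircuit) :
    ∀ k ≤ C.m, ∀ w, C.layeredGraph.Matched k w ↔
      C.Front 0 (fun z => z < k ∧ C.input z) (fun _ => False) w
  | 0, _, w => by simp [RawGraph.Matched, Front]
  | k + 1, hk, w => by
    have ih := matched_inputs C k (by omega)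
    have hk' : k < C.m := hk
    by_cases hin : C.input k
    · rw [RawGraph.matched_succ_of_least (w₀ := C.place 0 k), ih, front_or_place hk']
      · refine front_congr (fun z _ => ?_) (fun _ _ => Iff.rfl) w
        grind
      · exact (place_lt_size (Nat.zero_le _) hk').trans (Nat.lt_succ_self _)
      · exact (adj_input hk' _).2 ⟨rfl, hin⟩
      · rw [ih, front_place hk']
        simp
      · intro w hw hadj
        exact absurd ((adj_input hk' w).1 hadj).1 hw.ne
    · rw [RawGraph.matched_succ_of_isolated, ih]
      · refine front_congr (fun z _ => ?_) (fun _ _ => Iff.rfl) w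
        grind
      · exact fun w h => hin ((adj_input hk' w).1 h).2

/-- One bottom node of a layer. If wire `k` carries `0`, the node takes the free top node `(l, k)`;
otherwise it moves on to layer `l + 1`, where `place` makes it prefer the disjunction output. -/
theorem matched_layer_succ {C : RawCircuit} (hC : C.OkPos) {l k : ℕ} (hl : l < C.n) (hk : k < C.m)
    (ih : ∀ w, C.layeredGraph.Matched ((l + 1) * C.m + k) w ↔
      C.Front l (fun z => z < k ∨ C.state l z)
        (Received (C.state l) (C.fst l) (C.snd l) k) w) (w : ℕ) :
    C.layeredGraph.Matched ((l + 1) * C.m + k + 1) w ↔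
      C.Front l (fun z => z < k + 1 ∨ C.state l z)
        (Received (C.state l) (C.fst l) (C.snd l) (k + 1)) w := by
  have hx := (hC.1.2 l hl).1
  have hy := (hC.1.2 l hl).2 (hC.2 l hl)
  have hadj := adj_gate hl hk
  have hsize {z : ℕ} (hz : z < C.m) : C.place (l + 1) z < C.layeredGraph.n :=
    (place_lt_size hl hz).trans (Nat.lt_succ_self _)
  by_cases hB : C.state l k
  · have hP (z : ℕ) : z < k + 1 ∨ C.state l z ↔ z < k ∨ C.state l z := by
      grind
    have hdone : C.layeredGraph.Matched ((l + 1) * C.m + k) (C.place l k) := by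
      rw [ih, front_place hk]
      exact Or.inr hB
    by_cases hon : C.OnGate l k
    · by_cases hfirst : Received (C.state l) (C.fst l) (C.snd l) k (C.snd l)
      · rw [RawGraph.matched_succ_of_least (w₀ := C.place (l + 1) (C.fst l)), ih,
          front_or_place_succ hx]
        · exact front_congr (fun z _ => (hP z).symm)
            (fun z _ => (received_succ_of_second hB hon hfirst z).symm) w
        · exact hsize hx
        · exact (hadj _).2 (Or.inr ⟨_, hx, rfl, Or.inr ⟨hon, Or.inl rfl⟩⟩)
        · rw [ih, front_place_succ hx]
          exact not_received_of_second hon hfirst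
        · intro w hw hvw
          rcases (hadj w).1 hvw with rfl | ⟨z', hz', rfl, h⟩
          · exact hdone
          · have hz'' : C.OnGate l z' := by
              rcases h with rfl | h
              · exact hon
              · exact h.2
            rcases hz'' with rfl | rfl
            · exact absurd hw (lt_irrefl _)
            · rwa [ih, front_place_succ hy]
      · rw [RawGraph.matched_succ_of_least (w₀ := C.place (l + 1) (C.snd l)), ih,
          front_or_place_succ hy]
        · exact front_congr (fun z _ => (hP z).symm)
            (fun z _ => (received_succ_of_first hB hon hfirst z).symm) w
        · exact hsize hy
        · exact (hadj _).2 (Or.inr ⟨_, hy, rfl, Or.inr ⟨hon, Or.inr rfl⟩⟩)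
        · rwa [ih, front_place_succ hy]
        · intro w hw hvw
          rcases (hadj w).1 hvw with rfl | ⟨z', hz', rfl, h⟩
          · exact hdone
          · rw [place_snd] at hw
            exact absurd hw (C.le_place (l + 1) z').not_gt
    · have hne := not_or.1 hon
      rw [RawGraph.matched_succ_of_least (w₀ := C.place (l + 1) k), ih, front_or_place_succ hk]
      · exact front_congr (fun z _ => (hP z).symm)
          (fun z _ => (received_succ_of_off hB hne.1 hne.2 z).symm) w
      · exact hsize hk
      · exact (hadj _).2 (Or.inr ⟨_, hk, rfl, Or.inl rfl⟩)
      · rw [ih, front_place_succ hk, Received]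
        simp [hne.1, hne.2]
      · intro w hw hvw
        rcases (hadj w).1 hvw with rfl | ⟨z', hz', rfl, rfl | h⟩
        · exact hdone
        · exact absurd hw (lt_irrefl _)
        · exact absurd h.1 hon
  · rw [RawGraph.matched_succ_of_least (w₀ := C.place l k), ih, front_or_place hk]
    · refine front_congr (fun z _ => ?_) (fun z _ => (received_succ_of_not hB z).symm) w
      grind
    · exact (place_lt_size hl.le hk).trans (Nat.lt_succ_self _)
    · exact (hadj _).2 (Or.inl rfl)
    · rw [ih, front_place hk]
      simp [hB]
    · intro w hw hvw
      rcases (hadj w).1 hvw with rfl | ⟨z', hz', rfl, h⟩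
      · exact absurd hw (lt_irrefl _)
      · exact absurd hw (place_lt_place z' (Nat.lt_succ_self l) hk).not_gt

/-- When the bottom nodes before layer `l` have been processed, the layers before `l` are full,
layer `l` holds the state of the wires after `l` gates, and the later layers are empty. -/
theorem matched_layers {C : RawCircuit} (hC : C.OkPos) :
    ∀ l ≤ C.n, ∀ w, C.layeredGraph.Matched ((l + 1) * C.m) w ↔
      C.Front l (C.state l) (fun _ => False) w
  | 0, _, w => by
    rw [zero_add, one_mul, matched_inputs C _ le_rfl]
    exact front_congr (fun z hz => by simp [hz, state]) (fun _ _ => Iff.rfl) w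
  | l + 1, hl, w => by
    have ih := matched_layers hC l (by omega)
    have key : ∀ k ≤ C.m, ∀ w, C.layeredGraph.Matched ((l + 1) * C.m + k) w ↔
        C.Front l (fun z => z < k ∨ C.state l z)
          (Received (C.state l) (C.fst l) (C.snd l) k) w := by
      intro k
      induction k with
      | zero =>
        intro _ w
        rw [add_zero, ih]
        exact front_congr (fun z _ => by simp)
          (fun z _ => by simp [not_received_zero]) w
      | succ k ihk => exact fun hk => matched_layer_succ hC hl hk (ihk (by omega))
    rw [Nat.succ_mul, key C.m le_rfl, front_next w fun z hz => Or.inl hz]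
    exact front_congr (fun z hz => received_iff_state hC hl hz) (fun _ _ => Iff.rfl) w

theorem layeredGraph_chosen {C : RawCircuit} (hC : C.OkPos) :
    C.layeredGraph.Chosen C.layeredGraph.bot C.layeredGraph.top ↔ C.Val := by
  have hout := hC.1.1
  have hm := matched_layers hC C.n le_rfl
  have hlast : C.layeredGraph.Matched ((C.n + 1) * C.m) (C.place C.n C.out) ↔ C.Val := by
    rw [hm, front_place hout]
    rfl
  have hfree : ¬ C.layeredGraph.Matched ((C.n + 1) * C.m) ((C.n + 1) * (C.m + 1)) := by
    rw [hm]
    rintro (⟨l', hl', z, hz, h⟩ | ⟨z, hz, h, -⟩ | ⟨_, _, _, h⟩)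
    · exact absurd h (place_lt_size hl'.le hz).ne'
    · exact absurd h (place_lt_size le_rfl hz).ne'
    · exact h
  change C.layeredGraph.Chosen ((C.n + 1) * C.m) ((C.n + 1) * (C.m + 1)) ↔ _
  rw [← hlast]
  constructor
  · exact fun h => h.2.2.2 _ (place_lt_size le_rfl hout) ((adj_last _).2 (Or.inl rfl))
  · intro h
    refine ⟨Nat.lt_succ_self _, (adj_last _).2 (Or.inr rfl), hfree, fun w hw hadj => ?_⟩
    rcases (adj_last w).1 hadj with rfl | rfl
    · exact h
    · exact absurd hw (lt_irrefl _)

theorem layeredGraph_matched {C : RawCircuit} (hC : C.OkPos) :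
    C.layeredGraph.Matched C.layeredGraph.m C.layeredGraph.top ↔ C.Val := by
  rw [← layeredGraph_chosen hC]
  change C.layeredGraph.Matched ((C.n + 1) * C.m + 1) _ ↔ _
  rw [RawGraph.matched_succ]
  refine or_iff_right fun h => ?_
  rw [matched_layers hC C.n le_rfl] at h
  rcases h with ⟨l', hl', z, hz, h⟩ | ⟨z, hz, h, -⟩ | ⟨_, _, _, h⟩
  · exact absurd h (place_lt_size hl'.le hz).ne'
  · exact absurd h (place_lt_size le_rfl hz).ne'
  · exact h

theorem layeredGraph_degLe {C : RawCircuit} (hC : C.OkPos) : C.layeredGraph.DegLe := by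
  have hout := hC.1.1
  have hplace {l z : ℕ} (hl : l ≤ C.n) (hz : z < C.m) : C.place l z < C.layeredGraph.n + 1 :=
    (place_lt_size hl hz).trans (Nat.lt_succ_of_lt (Nat.lt_succ_self _))
  have hbot {l z : ℕ} (hl : l ≤ C.n) (hz : z < C.m) :
      l * C.m + z < C.layeredGraph.m + 1 :=
    (row_lt (Nat.lt_succ_of_le hl) hz).trans (Nat.lt_succ_of_lt (Nat.lt_succ_self _))
  have hlast : (C.n + 1) * C.m < C.layeredGraph.m + 1 := Nat.lt_succ_of_lt (Nat.lt_succ_self _)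
  constructor
  · intro v hv
    rcases Nat.lt_succ_iff_lt_or_eq.1 (show v < (C.n + 1) * C.m + 1 from hv) with hv | rfl
    · have hdiv := Nat.div_lt_of_lt_mul (hv.trans_eq (mul_comm _ _))
      have hz := Nat.mod_lt v (show 0 < C.m by omega)
      rw [← Nat.div_add_mod' v C.m]
      generalize v / C.m = r at *
      generalize v % C.m = z at *
      rcases r with _ | l
      · refine ⟨_, hplace (Nat.zero_le _) hz, _, hplace (Nat.zero_le _) hz, _,
          hplace (Nat.zero_le _) hz, fun w _ h => ?_⟩
        rw [zero_mul, zero_add, adj_input hz] at h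
        exact Or.inl h.1
      · have hl : l < C.n := by omega
        have hx := (hC.1.2 l hl).1
        have hy := (hC.1.2 l hl).2 (hC.2 l hl)
        by_cases hon : C.OnGate l z
        · refine ⟨_, hplace hl.le hz, _, hplace hl hx, _, hplace hl hy, fun w _ hvw => ?_⟩
          rcases (adj_gate hl hz w).1 hvw with h | ⟨z', -, rfl, h⟩
          · exact Or.inl h
          · have hz' : C.OnGate l z' := by
              rcases h with rfl | h
              · exact hon
              · exact h.2
            rcases hz' with rfl | rfl
            · exact Or.inr (Or.inl rfl)
            · exact Or.inr (Or.inr rfl)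
        · refine ⟨_, hplace hl.le hz, _, hplace hl hz, _, hplace hl hz, fun w _ hvw => ?_⟩
          rcases (adj_gate hl hz w).1 hvw with h | ⟨z', -, rfl, rfl | h⟩
          · exact Or.inl h
          · exact Or.inr (Or.inl rfl)
          · exact absurd h.1 hon
    · refine ⟨_, hplace le_rfl hout, _, hplace le_rfl hout, (C.n + 1) * (C.m + 1),
        Nat.lt_succ_of_lt (Nat.lt_succ_self _), fun w _ h => ?_⟩
      rcases (adj_last w).1 h with h | h
      · exact Or.inl h
      · exact Or.inr (Or.inr h)
  · intro w _
    by_cases hw : ∃ l ≤ C.n, ∃ z < C.m, w = C.place l z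
    · obtain ⟨l, hl, z, hz, rfl⟩ := hw
      -- The neighbour of the top node `(l, z)` that consumes its `1`.
      obtain ⟨c, hc, hc'⟩ : ∃ c < C.layeredGraph.m + 1, (l < C.n → c = (l + 1) * C.m + z) ∧
          (l = C.n → c = (C.n + 1) * C.m) := by
        rcases hl.lt_or_eq with hl | rfl
        · exact ⟨_, hbot hl hz, fun _ => rfl, fun h => absurd h hl.ne⟩
        · exact ⟨_, hlast, fun h => absurd h (lt_irrefl _), fun _ => rfl⟩
      rcases l with _ | l
      · refine ⟨_, hbot (Nat.zero_le _) hz, _, hbot (Nat.zero_le _) hz, c, hc, ?_⟩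
        rintro v - (⟨z', hz', rfl, h, -⟩ | ⟨l', hl', z', hz', rfl, h | ⟨z'', hz'', h, -⟩⟩ |
          ⟨rfl, h | h⟩)
        · obtain ⟨-, rfl⟩ := (place_inj hz hz').1 h
          simp
        · obtain ⟨rfl, rfl⟩ := (place_inj hz hz').1 h
          exact Or.inr (Or.inr (hc'.1 hl').symm)
        · have := (place_inj hz hz'').1 h
          omega
        · obtain ⟨hn, -⟩ := (place_inj hz hout).1 h
          exact Or.inr (Or.inr (hc'.2 hn).symm)
        · exact absurd h (place_lt_size hl hz).ne
      · have hx := (hC.1.2 l hl).1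
        have hy := (hC.1.2 l hl).2 (hC.2 l hl)
        have hupper : ∀ v, C.layeredGraph.adj v (C.place (l + 1) z) → v = c ∨
            ∃ z', z' < C.m ∧ v = (l + 1) * C.m + z' ∧
              (z' = z ∨ C.OnGate l z' ∧ C.OnGate l z) := by
          rintro v (⟨z', hz', rfl, h, -⟩ | ⟨l', hl', z', hz', rfl, h | ⟨z'', hz'', h, h'⟩⟩ |
            ⟨rfl, h | h⟩)
          · have := (place_inj hz hz').1 h
            omega
          · obtain ⟨rfl, rfl⟩ := (place_inj hz hz').1 h
            exact Or.inl (hc'.1 hl').symm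
          · obtain ⟨hl'', rfl⟩ := (place_inj hz hz'').1 h
            obtain rfl : l = l' := by omega
            exact Or.inr ⟨z', hz', rfl, h'⟩
          · obtain ⟨hn, -⟩ := (place_inj hz hout).1 h
            exact Or.inl (hc'.2 hn).symm
          · exact absurd h (place_lt_size hl hz).ne
        by_cases hon : C.OnGate l z
        · refine ⟨_, hbot hl hx, _, hbot hl hy, c, hc, fun v _ hvw => ?_⟩
          rcases hupper v hvw with h | ⟨z', -, rfl, h⟩
          · exact Or.inr (Or.inr h)
          · have hz' : C.OnGate l z' := by
              rcases h with rfl | h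
              · exact hon
              · exact h.1
            rcases hz' with rfl | rfl
            · exact Or.inl rfl
            · exact Or.inr (Or.inl rfl)
        · refine ⟨_, hbot hl hz, _, hbot hl hz, c, hc, fun v _ hvw => ?_⟩
          rcases hupper v hvw with h | ⟨z', -, rfl, rfl | h⟩
          · exact Or.inr (Or.inr h)
          · exact Or.inl rfl
          · exact absurd h.2 hon
    · refine ⟨_, hlast, _, hlast, _, hlast, ?_⟩
      rintro v - (⟨z, hz, -, h, -⟩ | ⟨l, hl, z, hz, -, h | ⟨z', hz', h, -⟩⟩ | ⟨h, -⟩)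
      · exact absurd ⟨0, Nat.zero_le _, z, hz, h⟩ hw
      · exact absurd ⟨l, hl.le, z, hz, h⟩ hw
      · exact absurd ⟨l + 1, hl, z', hz', h⟩ hw
      · exact Or.inl h

theorem layeredGraph_edge (C : RawCircuit) :
    C.layeredGraph.bot < C.layeredGraph.m ∧ C.layeredGraph.top < C.layeredGraph.n ∧
      C.layeredGraph.adj C.layeredGraph.bot C.layeredGraph.top :=
  ⟨Nat.lt_succ_self _, Nat.lt_succ_self _, (adj_last _).2 (Or.inr rfl)⟩

end RawCircuit

theorem ccv_reducible_vLfmm3 : AC0Reducible Ccv VLfmm3 := by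
  rw [vLfmm3_eq]
  exact RawCircuit.ccvPresentation.reducible (RawGraph.presentationV True)
    RawCircuit.layeredGraph (fun C _ => RawCircuit.Definable.layeredGraph C)
    fun C hC => ⟨⟨C.layeredGraph_edge.2.1, fun _ => RawCircuit.layeredGraph_degLe hC⟩,
      RawCircuit.layeredGraph_matched hC⟩

theorem ccv_reducible_lfmm3 : AC0Reducible Ccv Lfmm3 := by
  rw [lfmm3_eq]
  exact RawCircuit.ccvPresentation.reducible (RawGraph.presentationE True)
    RawCircuit.layeredGraph (fun C _ => RawCircuit.Definable.layeredGraph C)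
    fun C hC => ⟨⟨C.layeredGraph_edge, fun _ => RawCircuit.layeredGraph_degLe hC⟩,
      RawCircuit.layeredGraph_chosen hC⟩

/-- Each of the six problems is equivalent to the circuit value problem. -/
theorem ccv_equivalent {P : Language Bool}
    (hP : P ∈ [Ccv, VLfmm3, VLfmm, CcvNeg, Lfmm3, Lfmm]) : AC0Equivalent Ccv P := by
  have hV := ccv_reducible_vLfmm3.trans vLfmm3_reducible_vLfmm
  have hE := ccv_reducible_lfmm3.trans lfmm3_reducible_lfmm
  have hV' := vLfmm_reducible_ccvNeg.trans ccvNeg_reducible_ccv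
  have hE' := lfmm_reducible_ccvNeg.trans ccvNeg_reducible_ccv
  simp only [List.mem_cons, List.not_mem_nil, or_false] at hP
  rcases hP with rfl | rfl | rfl | rfl | rfl | rfl
  · exact ⟨AC0Reducible.refl _, AC0Reducible.refl _⟩
  · exact ⟨ccv_reducible_vLfmm3, vLfmm3_reducible_vLfmm.trans hV'⟩
  · exact ⟨hV, hV'⟩
  · exact ⟨hV.trans vLfmm_reducible_ccvNeg, ccvNeg_reducible_ccv⟩
  · exact ⟨ccv_reducible_lfmm3, lfmm3_reducible_lfmm.trans hE'⟩
  · exact ⟨hE, hE'⟩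

end ComparatorCC

theorem corollary5p2 :
    ∀ P ∈ [ComparatorCC.Ccv, ComparatorCC.VLfmm3, ComparatorCC.VLfmm, ComparatorCC.CcvNeg,
        ComparatorCC.Lfmm3, ComparatorCC.Lfmm],
      ∀ Q ∈ [ComparatorCC.Ccv, ComparatorCC.VLfmm3, ComparatorCC.VLfmm, ComparatorCC.CcvNeg,
        ComparatorCC.Lfmm3, ComparatorCC.Lfmm],
        ComparatorCC.AC0Equivalent P Q := by
  intro P hP Q hQ
  have h := ComparatorCC.ccv_equivalent hP
  have h' := ComparatorCC.ccv_equivalent hQ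
  exact ⟨h.2.trans h'.1, h'.2.trans h.1⟩
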